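/- **Setting.** Let $N\ge 2$, $A\in M_n(\mathbb R)$, $B\in M_{n\times m}(\mathbb R)$ with $(A,B)$ stabilizable (there is $K_1\in M_{m\times n}(\mathbb R)$ such that all eigenvalues of $A+BK_1$ have negative real part). Let $\mathcal G$ be an undirected signed graph on $\{1,\dots,N\}$ with symmetric weight matrix $\mathcal W=(w_{ij})$, $w_{ii}=0$ ($i,j$ are adjacent iff $w_{ij}\neq0$), which is connected and structurally balanced (the vertices split into two parts such that weights inside a part are $\ge 0$ and weights between the parts are $\le 0$). Let $L=\mathrm{diag}\big(\sum_j|w_{ij}|\big)_i-\mathcal W$, let $\sigma_1,\dots,\sigma_N\in\{1,-1\}$ be such that $D\mathcal WD$ has nonnegative entries, $D=\mathrm{diag}(\sigma_1,\dots,\sigma_N)$, and put $L_D=DLD$. Let $\alpha(L)=\min\{y^TLy/y^Ty : y\ne0,\ y\perp\ker L\}$, the smallest positive eigenvalue of $L$. Let $P\in M_n(\mathbb R)$ be symmetric positive definite and $\kappa>0$ with $$A^TP+PA-\alpha(L)PBB^TP<-\kappa I_n ,$$ and let $K=B^TP$. Let $h:[0,\infty)\to(0,\infty)$ be continuous with $\int_0^\infty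 h(s)\,ds=1$. Let $c>0$ be such that $\beta:=\kappa-c\|L_D\otimes PBB^TP\|^2>0$, and let $\beta_1,\dots,\beta_N$ satisfy $$0<\beta_i<\min\Big\{\frac1{2\|L_D\|^2},\ \frac{\beta c}{2\|L_D\|^2(\beta c+1)}\Big\},$$ where $\|\cdot\|$ is the Euclidean operator norm. **Closed loop.** A trajectory consists of continuous $x_i:[0,\infty)\to\mathbb R^n$ and triggering instants $0=t_0^i\le t_1^i\le\cdots\le\infty$ ($i=1,\dots,N$) with $$\dot x_i=Ax_i+Bu_i,\qquad u_i(t)=-K\sum_{j=1}^N|w_{ij}|\big(\hat x_i(t)-\mathrm{sgn}(w_{ij})\hat x_j(t)\big),$$ the derivative being the right derivative, for all $t\ge0$. Here $\hat x_i(t)=e^{(t-r)A}x_i(r)$, where $r$ is the last triggering instant of agent $i$ not later than $t$ (the supremum of the triggering instants $\le t$, if these accumulate). The instants are determined by $$t_{k+1}^i=\inf\{t>t_k^i: f_i^k(t)>0\}\quad(\inf\emptyset=\infty),\qquad f_i^k(t)=\int_{t_k^i}^t\Big(\|\hat z_i(s)-z_i(s)\|^2-\beta_i\Big\|\sum_{j=1}^N|w_{ij}|(\hat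 z_i(s)-\hat z_j(s))\Big\|^2-\beta_ih(s)\Big)ds,$$ where $z_i=\sigma_ix_i$, $\hat z_j=\sigma_j\hat x_j$ for $j\ne i$, and, in $f_i^k$, $\hat z_i(s)=\sigma_ie^{(s-t_k^i)A}x_i(t_k^i)$ (agent $i$ keeps the sample taken at $t_k^i$). **Theorem.** Every trajectory achieves bipartite consensus: $\lim_{t\to\infty}\|\sigma_ix_i(t)-\sigma_jx_j(t)\|=0$ for all $i,j$. Moreover the system has a positive minimum inter-event time: there is $\tau>0$, the same for all trajectories, such that $t_{k+1}^i-t_k^i\ge\tau$ for all $i$ and all $k$ with $t_k^i<\infty$. -/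

import Mathlib

open Set Filter Topology MeasureTheory
open scoped Matrix Kronecker

noncomputable section

/-- A (weighted, undirected) signed graph on the vertices `0, …, N-1`, without self-loops:
a symmetric real matrix of signed weights with zero diagonal; `i` and `j` are joined by an
edge exactly when `w i j ≠ 0`. -/
structure SignedGraph (N : ℕ) where
  w : Matrix (Fin N) (Fin N) ℝ
  symm : ∀ i j, w i j = w j i
  no_loops : ∀ i, w i i = 0

namespace SignedGraph

variable {N : ℕ}

/-- The underlying simple graph. -/
def toSimpleGraph (G : SignedGraph N) : SimpleGraph (Fin N) where
  Adj i j := G.w i j ≠ 0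
  symm := ⟨fun i j hij => by rw [← G.symm i j]; exact hij⟩
  loopless := ⟨fun i hi => hi (G.no_loops i)⟩

/-- The Laplacian `L = C - W` with `C = diag (∑ⱼ |w i j|)`. -/
def laplacian (G : SignedGraph N) : Matrix (Fin N) (Fin N) ℝ :=
  Matrix.diagonal (fun i => ∑ j, |G.w i j|) - G.w

/-- Structural balance: there is a bipartition `S`, `Sᶜ` of the vertices such that weights
inside a part are nonnegative and weights between the parts are nonpositive. -/
def StructurallyBalanced (G : SignedGraph N) : Prop :=
  ∃ S : Set (Fin N),
    (∀ i j, (i ∈ S ↔ j ∈ S) → 0 ≤ G.w i j) ∧ (∀ i j, ¬ (i ∈ S ↔ j ∈ S) → G.w i j ≤ 0)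

/-- `σ` is a sign vector such that, for `D = diag σ`, all entries of `D W D` are nonnegative. -/
def IsGauge (G : SignedGraph N) (σ : Fin N → ℝ) : Prop :=
  (∀ i, σ i = 1 ∨ σ i = -1) ∧
    ∀ i j, 0 ≤ (Matrix.diagonal σ * G.w * Matrix.diagonal σ) i j

/-- The transformed Laplacian `L_D = D L D`, `D = diag σ`. -/
def gaugedLaplacian (G : SignedGraph N) (σ : Fin N → ℝ) : Matrix (Fin N) (Fin N) ℝ :=
  Matrix.diagonal σ * G.laplacian * Matrix.diagonal σ

end SignedGraph

/-- The general algebraic connectivity `α(L)`: the minimum of the Rayleigh quotient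
`yᵀ L y / yᵀ y` over the nonzero vectors `y` that are orthogonal to the (left) null vectors `ξ`
of `L`. For the Laplacian of a connected, structurally balanced signed graph the null space is
one-dimensional, and this is the smallest positive eigenvalue of `L`. -/
def algConnectivity {N : ℕ} (L : Matrix (Fin N) (Fin N) ℝ) : ℝ :=
  sInf {q : ℝ | ∃ y : Fin N → ℝ, y ≠ 0 ∧ (∀ ξ : Fin N → ℝ, ξ ᵥ* L = 0 → y ⬝ᵥ ξ = 0) ∧
    q = (y ⬝ᵥ (L *ᵥ y)) / (y ⬝ᵥ y)}

/-- The operator norm of a square matrix with respect to Euclidean norms. -/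
def opNorm {ι : Type*} [Fintype ι] [DecidableEq ι] (M : Matrix ι ι ℝ) : ℝ :=
  ‖Matrix.toEuclideanCLM (𝕜 := ℝ) M‖

/-- `(A, B)` is stabilizable: for some feedback matrix `K₁`, all complex eigenvalues of
`A + B K₁` have negative real part. -/
def Stabilizable {n m : ℕ} (A : Matrix (Fin n) (Fin n) ℝ) (B : Matrix (Fin n) (Fin m) ℝ) :
    Prop :=
  ∃ K₁ : Matrix (Fin m) (Fin n) ℝ,
    ∀ μ ∈ spectrum ℂ ((A + B * K₁).map (fun r : ℝ => (r : ℂ))), μ.re < 0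

section ClosedLoop

variable {N n m : ℕ}

/-- The open-loop prediction at time `s` of a state `v` sampled at time `r`: `e^{(s-r)A} v`. -/
def predict (A : Matrix (Fin n) (Fin n) ℝ) (r s : ℝ) (v : EuclideanSpace ℝ (Fin n)) :
    EuclideanSpace ℝ (Fin n) :=
  Matrix.toEuclideanLin (NormedSpace.exp ((s - r) • A)) v

/-- The most recent triggering instant not later than `s`, for a sequence of (possibly infinite)
triggering instants. The maximum is written as a supremum, so that it also makes sense
after an accumulation point of triggering instants: Zeno behavior is not ruled out by definition. -/
def lastTrigger (t : ℕ → EReal) (s : ℝ) : ℝ :=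
  sSup {r : ℝ | r ≤ s ∧ ∃ l, t l = (r : EReal)}

/-- The estimate `x̂ᵢ(s) = e^{(s - t_k) A} xᵢ(t_k)`, `t_k` being the last triggering instant. -/
def estimate (A : Matrix (Fin n) (Fin n) ℝ) (x : Fin N → ℝ → EuclideanSpace ℝ (Fin n))
    (t : Fin N → ℕ → EReal) (i : Fin N) (s : ℝ) : EuclideanSpace ℝ (Fin n) :=
  predict A (lastTrigger (t i) s) s (x i (lastTrigger (t i) s))

/-- The control input `uᵢ(s) = -K ∑ⱼ |w i j| (x̂ᵢ(s) - sgn(w i j) x̂ⱼ(s))`. -/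
def controlInput (G : SignedGraph N) (A : Matrix (Fin n) (Fin n) ℝ) (K : Matrix (Fin m) (Fin n) ℝ)
    (x : Fin N → ℝ → EuclideanSpace ℝ (Fin n)) (t : Fin N → ℕ → EReal) (i : Fin N) (s : ℝ) :
    EuclideanSpace ℝ (Fin m) :=
  -Matrix.toEuclideanLin K
    (∑ j, |G.w i j| • (estimate A x t i s - Real.sign (G.w i j) • estimate A x t j s))

/-- The integrand `‖ê‖² - βᵢ ‖∑ⱼ |w i j| (ẑᵢ - ẑⱼ)‖² - βᵢ h` of the triggering function, for agent
`i` holding the sample it took at time `r`: here `ẑᵢ(s) = σᵢ e^{(s-r)A} xᵢ(r)`,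
`ê = ẑᵢ(s) - σᵢ xᵢ(s)`, and `ẑⱼ(s) = σⱼ x̂ⱼ(s)` for the other agents (the term `j = i` has weight `w i i = 0`). -/
def triggerIntegrand (G : SignedGraph N) (σ : Fin N → ℝ) (A : Matrix (Fin n) (Fin n) ℝ)
    (β : Fin N → ℝ) (h : ℝ → ℝ) (x : Fin N → ℝ → EuclideanSpace ℝ (Fin n))
    (t : Fin N → ℕ → EReal) (i : Fin N) (r s : ℝ) : ℝ :=
  ‖σ i • predict A r s (x i r) - σ i • x i s‖ ^ 2
    - β i * ‖∑ j,
        |G.w i j| • (σ i • predict A r s (x i r) - σ j • estimate A x t j s)‖ ^ 2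
    - β i * h s

/-- The triggering function `f_i^k(s) = ∫_{t_k^i}^s g_i`. In it agent `i` holds the sample taken at
`t_k^i`, as it does until its next triggering instant, the one that `f_i^k` determines. -/
def triggerFunction (G : SignedGraph N) (σ : Fin N → ℝ) (A : Matrix (Fin n) (Fin n) ℝ)
    (β : Fin N → ℝ) (h : ℝ → ℝ) (x : Fin N → ℝ → EuclideanSpace ℝ (Fin n))
    (t : Fin N → ℕ → EReal) (i : Fin N) (k : ℕ) (s : ℝ) : ℝ :=
  ∫ q in (t i k).toReal..s, triggerIntegrand G σ A β h x t i (t i k).toReal q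

/-- `x` (states) and `t` (triggering instants) form a trajectory on `[0, ∞)` of the closed-loop
event-triggered system. Triggering instants live in `EReal`, with `inf ∅ = ⊤`: an instant `⊤`
means that no further event occurs. Since the control is piecewise continuous and
right-continuous, the equation of motion is imposed for the right derivative, together with
continuity of the state. -/
structure IsTrajectory (G : SignedGraph N) (σ : Fin N → ℝ) (A : Matrix (Fin n) (Fin n) ℝ)
    (B : Matrix (Fin n) (Fin m) ℝ) (K : Matrix (Fin m) (Fin n) ℝ) (β : Fin N → ℝ) (h : ℝ → ℝ)
    (x : Fin N → ℝ → EuclideanSpace ℝ (Fin n)) (t : Fin N → ℕ → EReal) : Prop where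
  continuousOn : ∀ i, ContinuousOn (x i) (Ici 0)
  dynamics : ∀ i, ∀ s : ℝ, 0 ≤ s →
    HasDerivWithinAt (x i)
      (Matrix.toEuclideanLin A (x i s) + Matrix.toEuclideanLin B (controlInput G A K x t i s))
      (Ici s) s
  first_trigger : ∀ i, t i 0 = 0
  next_trigger : ∀ i k, t i (k + 1) =
    sInf {T : EReal | ∃ s : ℝ, T = (s : EReal) ∧ t i k < (s : EReal) ∧
      0 < triggerFunction G σ A β h x t i k s}

end ClosedLoop

end

/-!
In the gauge `σ` the signed network becomes an ordinary one: with `zᵢ = σᵢ xᵢ` the weights are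
`|w i j|`, the gauged Laplacian `L_D = D L D` is the Laplacian of a connected graph, and bipartite
consensus is consensus of the `zᵢ`. Let `yᵢ` be the deviation of `zᵢ` from the average
(`disagreement`), `eᵢ = ẑᵢ - zᵢ` the `samplingError`, and
`qᵢ = ∑ⱼ |w i j| (ẑᵢ - ẑⱼ) = (L_D (y + e))ᵢ` the `relEstimate`. Then `yᵢ' = A yᵢ - B K qᵢ`.

*Minimum inter-event time* (`IsTrajectory.trigger_add_le`). After a triggering instant the error
of the held sample starts from zero and satisfies `ε' = A ε + B K q`; by a Gronwall estimate
`∫ ‖ε‖² ≤ O(τ) ∫ ‖qᵢ‖²` over an interval of length `τ`, with a constant depending on `A` and `B K`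
only. For small `τ` this is at most `βᵢ ∫ ‖qᵢ‖²`, so the triggering function stays negative
because of its term `-βᵢ ∫ h`. Signals are only known to be measurable and locally bounded at this
stage, which suffices, as accumulation of events is not excluded beforehand.

*Consensus.* By the spectral gap of `L_D` on vectors with zero sum and the matrix inequality for
`P`, the function `V = ∑ᵢ yᵢᵀ P yᵢ` satisfies `V' ≤ -b ‖y‖² + ‖e‖² / c` (`lyapunov_decay`). Since
triggering instants do not accumulate, the triggering rule can be summed over the inter-event
intervals, giving `∫ ‖eᵢ‖² ≤ βᵢ ∫ ‖qᵢ‖² + βᵢ`. As `‖q‖² ≤ 2 ‖L_D‖² (‖y‖² + ‖e‖²)`, the bound on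
the `βᵢ` yields `∫ ‖e‖² ≤ θ ∫ ‖y‖² + C` with `θ / c < b`
(`IsTrajectory.integral_sum_samplingError_le`). So `‖y‖²` and `‖e‖²` are integrable on `[0, ∞)`;
`V` becomes small at some late time, and can afterwards grow by at most the tail of `∫ ‖e‖² / c`
(`tendsto_zero_of_dissipation`).
-/

/-! ### The gauged Laplacian and its spectral gap -/

namespace SignedGraph

variable {N : ℕ} {G : SignedGraph N} {σ : Fin N → ℝ}

lemma IsGauge.mul_self (hσ : G.IsGauge σ) (i : Fin N) : σ i * σ i = 1 := by
  rcases hσ.1 i with h | h <;> simp [h]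

lemma IsGauge.abs_weight (hσ : G.IsGauge σ) (i j : Fin N) : |G.w i j| = σ i * G.w i j * σ j := by
  have h0 := hσ.2 i j
  rw [Matrix.mul_diagonal, Matrix.diagonal_mul] at h0
  rw [← abs_of_nonneg h0, abs_mul, abs_mul]
  rcases hσ.1 i with h | h <;> rcases hσ.1 j with h' | h' <;> simp [h, h']

lemma IsGauge.abs_weight_mul_sign (hσ : G.IsGauge σ) (i j : Fin N) :
    |G.w i j| * (σ i * Real.sign (G.w i j)) = |G.w i j| * σ j := by
  have h1 : |G.w i j| * Real.sign (G.w i j) = G.w i j := by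
    rcases lt_trichotomy (G.w i j) 0 with h | h | h
    · rw [Real.sign_of_neg h, abs_of_neg h]; ring
    · simp [h]
    · rw [Real.sign_of_pos h, abs_of_pos h]; ring
  calc |G.w i j| * (σ i * Real.sign (G.w i j)) = σ i * (|G.w i j| * Real.sign (G.w i j)) := by ring
    _ = (σ i * G.w i j * σ j) * σ j := by
        rw [h1]; linear_combination (-(σ i * G.w i j)) * hσ.mul_self j
    _ = |G.w i j| * σ j := by rw [hσ.abs_weight]

/-- In the gauge `σ` the signed Laplacian is the Laplacian of the graph with weights `|w i j|`. -/
lemma IsGauge.gaugedLaplacian_apply (hσ : G.IsGauge σ) (i j : Fin N) :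
    G.gaugedLaplacian σ i j = (if i = j then ∑ k, |G.w i k| else 0) - |G.w i j| := by
  rw [gaugedLaplacian, Matrix.mul_diagonal, Matrix.diagonal_mul, laplacian, Matrix.sub_apply,
    Matrix.diagonal_apply, hσ.abs_weight i j]
  split_ifs with h
  · subst h
    linear_combination (∑ k, |G.w i k|) * hσ.mul_self i
  · ring

lemma IsGauge.sum_gaugedLaplacian_smul {M : Type*} [AddCommGroup M] [Module ℝ M]
    (hσ : G.IsGauge σ) (v : Fin N → M) (i : Fin N) :
    ∑ j, G.gaugedLaplacian σ i j • v j = ∑ j, |G.w i j| • (v i - v j) := by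
  simp [hσ.gaugedLaplacian_apply, sub_smul, smul_sub, Finset.sum_sub_distrib, ite_smul,
    Finset.sum_smul]

/-- The Dirichlet form of the gauged Laplacian. -/
lemma IsGauge.dotProduct_gaugedLaplacian (hσ : G.IsGauge σ) (v : Fin N → ℝ) :
    v ⬝ᵥ (G.gaugedLaplacian σ *ᵥ v) = (∑ i, ∑ j, |G.w i j| * (v i - v j) ^ 2) / 2 := by
  have h1 : v ⬝ᵥ (G.gaugedLaplacian σ *ᵥ v) = ∑ i, ∑ j, |G.w i j| * (v i * (v i - v j)) := by
    simp only [dotProduct, Matrix.mulVec]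
    refine Finset.sum_congr rfl fun i _ => ?_
    have := hσ.sum_gaugedLaplacian_smul v i
    simp only [smul_eq_mul] at this
    rw [this, Finset.mul_sum]
    exact Finset.sum_congr rfl fun j _ => by ring
  have h2 : v ⬝ᵥ (G.gaugedLaplacian σ *ᵥ v) = ∑ i, ∑ j, |G.w i j| * (v j * (v j - v i)) := by
    rw [h1, Finset.sum_comm]
    simp_rw [fun i j => G.symm i j]
  have h3 : ∑ i, ∑ j, |G.w i j| * (v i - v j) ^ 2 = ∑ i, ∑ j, |G.w i j| * (v i * (v i - v j))
      + ∑ i, ∑ j, |G.w i j| * (v j * (v j - v i)) := by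
    simp_rw [← Finset.sum_add_distrib]
    exact Finset.sum_congr rfl fun i _ => Finset.sum_congr rfl fun j _ => by ring
  rw [h3, ← h1, ← h2]; ring

lemma IsGauge.dotProduct_gaugedLaplacian_nonneg (hσ : G.IsGauge σ) (v : Fin N → ℝ) :
    0 ≤ v ⬝ᵥ (G.gaugedLaplacian σ *ᵥ v) := by
  rw [hσ.dotProduct_gaugedLaplacian]; positivity

lemma dotProduct_laplacian_mulVec (v : Fin N → ℝ) :
    (fun i => σ i * v i) ⬝ᵥ (G.laplacian *ᵥ fun i => σ i * v i)
      = v ⬝ᵥ (G.gaugedLaplacian σ *ᵥ v) := by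
  have h : (fun i => σ i * v i) = Matrix.diagonal σ *ᵥ v := by
    ext i; rw [Matrix.mulVec_diagonal]
  rw [h, gaugedLaplacian, ← Matrix.mulVec_mulVec, ← Matrix.mulVec_mulVec,
    Matrix.dotProduct_mulVec v (Matrix.diagonal σ), ← Matrix.mulVec_transpose,
    Matrix.diagonal_transpose]

/-- On a connected graph a null vector of the Laplacian is a multiple of the gauge. -/
lemma IsGauge.eq_of_vecMul_laplacian_eq_zero (hσ : G.IsGauge σ)
    (hconn : G.toSimpleGraph.Connected) {ξ : Fin N → ℝ} (hξ : ξ ᵥ* G.laplacian = 0) (i j : Fin N) :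
    σ i * ξ i = σ j * ξ j := by
  set v : Fin N → ℝ := fun i => σ i * ξ i with hv
  have hξv : (fun i => σ i * v i) = ξ := by
    ext i; simp only [hv]; linear_combination ξ i * hσ.mul_self i
  have h0 : v ⬝ᵥ (G.gaugedLaplacian σ *ᵥ v) = 0 := by
    rw [← dotProduct_laplacian_mulVec, hξv, Matrix.dotProduct_mulVec, hξ, zero_dotProduct]
  rw [hσ.dotProduct_gaugedLaplacian] at h0
  have h1 : ∑ i, ∑ j, |G.w i j| * (v i - v j) ^ 2 = 0 := by linarith
  have hadj : ∀ i j, G.toSimpleGraph.Adj i j → v i = v j := by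
    intro i j hij
    rw [Finset.sum_eq_zero_iff_of_nonneg (fun _ _ => by positivity)] at h1
    have h2 := h1 i (Finset.mem_univ i)
    rw [Finset.sum_eq_zero_iff_of_nonneg (fun _ _ => by positivity)] at h2
    have h3 := h2 j (Finset.mem_univ j)
    rcases mul_eq_zero.1 h3 with h | h
    · exact absurd (abs_eq_zero.1 h) hij
    · exact sub_eq_zero.1 (pow_eq_zero_iff two_ne_zero |>.1 h)
  have hwalk : ∀ {a b : Fin N}, G.toSimpleGraph.Walk a b → v a = v b := by
    intro a b p
    induction p with
    | nil => rfl
    | cons hab _ ih => exact (hadj _ _ hab).trans ih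
  obtain ⟨p⟩ := hconn.preconnected i j
  exact hwalk p

/-- The Rayleigh bound behind `algConnectivity`: since the null space of the Laplacian is spanned by
the gauge, vectors with zero sum are admissible after gauging. -/
lemma IsGauge.algConnectivity_mul_le (hσ : G.IsGauge σ) (hconn : G.toSimpleGraph.Connected)
    {v : Fin N → ℝ} (hv : ∑ i, v i = 0) :
    algConnectivity G.laplacian * (v ⬝ᵥ v) ≤ v ⬝ᵥ (G.gaugedLaplacian σ *ᵥ v) := by
  rcases eq_or_ne v 0 with rfl | hv0
  · simp
  have hsq : ∀ u : Fin N → ℝ, (fun i => σ i * u i) ⬝ᵥ (fun i => σ i * u i) = u ⬝ᵥ u := fun u =>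
    Finset.sum_congr rfl fun i _ => by linear_combination u i * u i * hσ.mul_self i
  have hpos : 0 < v ⬝ᵥ v :=
    lt_of_le_of_ne (Finset.sum_nonneg fun i _ => mul_self_nonneg _)
      (fun h => hv0 (dotProduct_self_eq_zero.1 h.symm))
  rw [← le_div_iff₀ hpos]
  refine csInf_le ⟨0, ?_⟩ ⟨fun i => σ i * v i, ?_, ?_, ?_⟩
  · rintro q ⟨y, -, -, rfl⟩
    have hy : y = fun i => σ i * (σ i * y i) := by
      ext i; linear_combination (-y i) * hσ.mul_self i
    refine div_nonneg ?_ (Finset.sum_nonneg fun i _ => mul_self_nonneg _)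
    rw [hy, dotProduct_laplacian_mulVec]
    exact hσ.dotProduct_gaugedLaplacian_nonneg _
  · intro h
    rw [← hsq, h] at hpos
    simp at hpos
  · intro ξ hξ
    obtain ⟨i₀⟩ := hconn.nonempty
    calc ∑ i, σ i * v i * ξ i = ∑ i, v i * (σ i₀ * ξ i₀) := Finset.sum_congr rfl fun i _ => by
          rw [← hσ.eq_of_vecMul_laplacian_eq_zero hconn hξ i i₀]; ring
      _ = 0 := by rw [← Finset.sum_mul, hv, zero_mul]
  · rw [dotProduct_laplacian_mulVec, hsq]

end SignedGraph

/-! ### Euclidean operator norms of matrices -/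

section OpNorm

variable {ι : Type*} [Fintype ι]

lemma norm_toLp_sq (v : ι → ℝ) : ‖WithLp.toLp 2 v‖ ^ 2 = v ⬝ᵥ v := by
  rw [EuclideanSpace.real_norm_sq_eq]
  exact Finset.sum_congr rfl fun i _ => by simp [pow_two]

variable [DecidableEq ι]

lemma mulVec_dotProduct_self_le (M : Matrix ι ι ℝ) (v : ι → ℝ) :
    (M *ᵥ v) ⬝ᵥ (M *ᵥ v) ≤ opNorm M ^ 2 * (v ⬝ᵥ v) := by
  rw [← norm_toLp_sq, ← norm_toLp_sq, ← Matrix.toEuclideanCLM_toLp (𝕜 := ℝ), ← mul_pow]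
  exact pow_le_pow_left₀ (norm_nonneg _) (ContinuousLinearMap.le_opNorm _ _) 2

/-- Young's inequality for a bilinear form, weighted by `c`. -/
lemma neg_dotProduct_mulVec_le {c : ℝ} (hc : 0 < c) (M : Matrix ι ι ℝ) (u v : ι → ℝ) :
    -(2 * (u ⬝ᵥ (M *ᵥ v))) ≤ c * opNorm M ^ 2 * (u ⬝ᵥ u) + 1 / c * (v ⬝ᵥ v) := by
  have h1 : |u ⬝ᵥ (M *ᵥ v)| ≤ ‖WithLp.toLp 2 u‖ * (opNorm M * ‖WithLp.toLp 2 v‖) := by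
    have := abs_real_inner_le_norm (WithLp.toLp 2 u : EuclideanSpace ℝ ι) (WithLp.toLp 2 (M *ᵥ v))
    rw [EuclideanSpace.inner_eq_star_dotProduct, star_trivial, dotProduct_comm] at this
    refine this.trans (mul_le_mul_of_nonneg_left ?_ (norm_nonneg _))
    rw [← Matrix.toEuclideanCLM_toLp (𝕜 := ℝ)]
    exact ContinuousLinearMap.le_opNorm _ _
  rw [← norm_toLp_sq, ← norm_toLp_sq v]
  set a := ‖WithLp.toLp 2 u‖
  set d := ‖WithLp.toLp 2 v‖
  have h2 : 0 ≤ c * (opNorm M * a - d / c) ^ 2 := by positivity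
  have h3 : c * (opNorm M * a - d / c) ^ 2
      = c * opNorm M ^ 2 * a ^ 2 + 1 / c * d ^ 2 - 2 * (a * (opNorm M * d)) := by
    field_simp; ring
  linarith [neg_abs_le (u ⬝ᵥ (M *ᵥ v))]

end OpNorm

/-! ### The algebraic Lyapunov inequality -/

section Static

variable {N n m : ℕ} {G : SignedGraph N} {σ : Fin N → ℝ}

/-- The relative inputs `∑ⱼ (L_D)ᵢⱼ vⱼ` are bounded by `‖L_D‖`, one coordinate at a time. -/
lemma sum_dotProduct_gaugedLaplacian_le (M : Matrix (Fin N) (Fin N) ℝ) (v : Fin N → Fin n → ℝ) :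
    ∑ i, (∑ j, M i j • v j) ⬝ᵥ (∑ j, M i j • v j) ≤ opNorm M ^ 2 * ∑ i, v i ⬝ᵥ v i := by
  simp only [dotProduct]
  rw [Finset.sum_comm, Finset.sum_comm (f := fun i a => v i a * v i a), Finset.mul_sum]
  refine Finset.sum_le_sum fun a _ => ?_
  have := mulVec_dotProduct_self_le M (fun i => v i a)
  simpa [dotProduct, Matrix.mulVec] using this

lemma sum_mul_dotProduct_mulVec_eq_kronecker (M : Matrix (Fin N) (Fin N) ℝ)
    (Q : Matrix (Fin n) (Fin n) ℝ) (u v : Fin N → Fin n → ℝ) :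
    ∑ i, u i ⬝ᵥ Q *ᵥ (∑ j, M i j • v j)
      = (fun p : Fin N × Fin n => u p.1 p.2) ⬝ᵥ ((M ⊗ₖ Q) *ᵥ fun p => v p.1 p.2) := by
  simp only [dotProduct, Matrix.mulVec, Fintype.sum_prod_type, Matrix.kroneckerMap_apply,
    Finset.sum_apply, Pi.smul_apply, smul_eq_mul, Finset.mul_sum]
  refine Finset.sum_congr rfl fun i _ => Finset.sum_congr rfl fun a _ => ?_
  rw [Finset.sum_comm]
  exact Finset.sum_congr rfl fun j _ => Finset.sum_congr rfl fun b _ => by ring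

lemma sum_dotProduct_prod (u : Fin N → Fin n → ℝ) :
    (fun p : Fin N × Fin n => u p.1 p.2) ⬝ᵥ (fun p => u p.1 p.2) = ∑ i, u i ⬝ᵥ u i := by
  simp [dotProduct, Fintype.sum_prod_type]

/-- The quadratic form of `L_D ⊗ CᵀC` is a sum of quadratic forms of `L_D`, one for each row
of `C`. -/
lemma sum_dotProduct_gram_eq (M : Matrix (Fin N) (Fin N) ℝ) (C : Matrix (Fin m) (Fin n) ℝ)
    (v : Fin N → Fin n → ℝ) :
    ∑ i, v i ⬝ᵥ (Cᵀ * C) *ᵥ (∑ j, M i j • v j)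
      = ∑ a, (fun i => (C *ᵥ v i) a) ⬝ᵥ (M *ᵥ fun i => (C *ᵥ v i) a) := by
  have h : ∀ i, v i ⬝ᵥ (Cᵀ * C) *ᵥ (∑ j, M i j • v j)
      = ∑ a, (C *ᵥ v i) a * ∑ j, M i j * (C *ᵥ v j) a := by
    intro i
    rw [← Matrix.mulVec_mulVec, Matrix.dotProduct_mulVec, Matrix.vecMul_transpose,
      Matrix.mulVec_sum]
    simp [dotProduct, Matrix.mulVec_smul]
  simp_rw [h]
  rw [Finset.sum_comm]
  rfl

/-- Infinitesimal form of the Lyapunov estimate: for `ẏᵢ = A yᵢ - B BᵀP ∑ⱼ (L_D)ᵢⱼ (yⱼ + eⱼ)` the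
function `∑ᵢ yᵢᵀ P yᵢ` decays at rate `b` up to the measurement errors `e`. -/
lemma lyapunov_decay (hσ : G.IsGauge σ) (hconn : G.toSimpleGraph.Connected)
    {A : Matrix (Fin n) (Fin n) ℝ} {B : Matrix (Fin n) (Fin m) ℝ}
    {P : Matrix (Fin n) (Fin n) ℝ} (hP : P.PosDef) {κ : ℝ}
    (hLMI : (-(κ • (1 : Matrix (Fin n) (Fin n) ℝ)) -
      (Aᵀ * P + P * A - algConnectivity G.laplacian • (P * B * Bᵀ * P))).PosDef)
    {c : ℝ} (hc : 0 < c) {b : ℝ}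
    (hb : b = κ - c * opNorm (G.gaugedLaplacian σ ⊗ₖ (P * B * Bᵀ * P)) ^ 2)
    (y e : Fin N → Fin n → ℝ) (hy : ∑ i, y i = 0) :
    ∑ i, 2 * (y i ⬝ᵥ P *ᵥ (A *ᵥ y i
        - B *ᵥ ((Bᵀ * P) *ᵥ ∑ j, G.gaugedLaplacian σ i j • (y j + e j))))
      ≤ -b * ∑ i, y i ⬝ᵥ y i + 1 / c * ∑ i, e i ⬝ᵥ e i := by
  set M := G.gaugedLaplacian σ
  set Q := P * B * Bᵀ * P with hQ
  have hPt : Pᵀ = P := by simpa using hP.1.eq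
  have hQC : (Bᵀ * P)ᵀ * (Bᵀ * P) = Q := by
    rw [Matrix.transpose_mul, Matrix.transpose_transpose, hPt]
    simp only [hQ, Matrix.mul_assoc]
  set α := algConnectivity G.laplacian
  have hterm : ∀ i, 2 * (y i ⬝ᵥ P *ᵥ (A *ᵥ y i - B *ᵥ ((Bᵀ * P) *ᵥ ∑ j, M i j • (y j + e j))))
      = y i ⬝ᵥ (Aᵀ * P + P * A) *ᵥ y i - 2 * (y i ⬝ᵥ Q *ᵥ ∑ j, M i j • y j)
        - 2 * (y i ⬝ᵥ Q *ᵥ ∑ j, M i j • e j) := by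
    intro i
    have h1 : y i ⬝ᵥ (Aᵀ * P) *ᵥ y i = y i ⬝ᵥ (P * A) *ᵥ y i := by
      rw [Matrix.dotProduct_mulVec, ← Matrix.mulVec_transpose, Matrix.transpose_mul,
        Matrix.transpose_transpose, hPt, dotProduct_comm]
    simp only [smul_add, Finset.sum_add_distrib, Matrix.mulVec_add, Matrix.mulVec_sub,
      Matrix.mulVec_mulVec, dotProduct_add, dotProduct_sub, Matrix.add_mulVec, h1]
    have h2 : P * (B * (Bᵀ * P)) = Q := by simp only [hQ, Matrix.mul_assoc]
    rw [h2]; ring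
  have hlmi : ∀ i, y i ⬝ᵥ (Aᵀ * P + P * A) *ᵥ y i ≤ α * (y i ⬝ᵥ Q *ᵥ y i) - κ * (y i ⬝ᵥ y i) := by
    intro i
    have := hLMI.posSemidef.dotProduct_mulVec_nonneg (y i)
    simp only [star_trivial, Matrix.sub_mulVec, Matrix.neg_mulVec, Matrix.smul_mulVec,
      Matrix.one_mulVec, dotProduct_sub, dotProduct_neg, dotProduct_smul, smul_eq_mul] at this
    linarith
  have hgram := sum_dotProduct_gram_eq M (Bᵀ * P) y
  have hgram1 := sum_dotProduct_gram_eq (1 : Matrix (Fin N) (Fin N) ℝ) (Bᵀ * P) y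
  rw [hQC] at hgram hgram1
  simp only [Matrix.one_apply, ite_smul, one_smul, zero_smul, Finset.sum_ite_eq, Finset.mem_univ,
    if_true, Matrix.one_mulVec] at hgram1
  -- Of the two copies of the form of `M ⊗ Q`, one is dropped and the other supplies `α`.
  have hnonneg : 0 ≤ ∑ i, y i ⬝ᵥ Q *ᵥ (∑ j, M i j • y j) := by
    rw [hgram]; exact Finset.sum_nonneg fun a _ => hσ.dotProduct_gaugedLaplacian_nonneg _
  have hgap : α * ∑ i, y i ⬝ᵥ Q *ᵥ y i ≤ ∑ i, y i ⬝ᵥ Q *ᵥ (∑ j, M i j • y j) := by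
    rw [hgram, hgram1, Finset.mul_sum]
    refine Finset.sum_le_sum fun a _ => hσ.algConnectivity_mul_le hconn ?_
    rw [← Finset.sum_apply, ← Matrix.mulVec_sum, hy, Matrix.mulVec_zero, Pi.zero_apply]
  have hcross := neg_dotProduct_mulVec_le hc (M ⊗ₖ Q) (fun p => y p.1 p.2) (fun p => e p.1 p.2)
  rw [← sum_mul_dotProduct_mulVec_eq_kronecker, sum_dotProduct_prod, sum_dotProduct_prod] at hcross
  have hsum := Finset.sum_le_sum fun i (_ : i ∈ Finset.univ) => hlmi i
  rw [Finset.sum_sub_distrib, ← Finset.mul_sum, ← Finset.mul_sum] at hsum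
  simp_rw [hterm]
  rw [Finset.sum_sub_distrib, Finset.sum_sub_distrib, ← Finset.mul_sum, ← Finset.mul_sum, hb]
  linarith

end Static

/-! ### Locally bounded signals -/

section LocallyBounded

variable {E : Type*} [NormedAddCommGroup E]

/-- Measurable functions on `[0, ∞)` that are bounded on compact intervals. The signals of the closed
loop are of this kind without any assumption on the accumulation of triggering instants. -/
structure LocallyBoundedMeasurable (f : ℝ → E) : Prop where
  aestronglyMeasurable : AEStronglyMeasurable f (volume.restrict (Ici 0))
  exists_bound : ∀ T, ∃ C, ∀ s ∈ Icc (0 : ℝ) T, ‖f s‖ ≤ C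

namespace LocallyBoundedMeasurable

variable {f g : ℝ → E}

lemma of_continuousOn (hf : ContinuousOn f (Ici 0)) : LocallyBoundedMeasurable f where
  aestronglyMeasurable := hf.aestronglyMeasurable measurableSet_Ici
  exists_bound _ := isCompact_Icc.exists_bound_of_continuousOn (hf.mono Icc_subset_Ici_self)

lemma add (hf : LocallyBoundedMeasurable f) (hg : LocallyBoundedMeasurable g) :
    LocallyBoundedMeasurable fun s => f s + g s where
  aestronglyMeasurable := hf.1.add hg.1
  exists_bound T := by
    obtain ⟨C, hC⟩ := hf.2 T
    obtain ⟨D, hD⟩ := hg.2 T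
    exact ⟨C + D, fun s hs => (norm_add_le _ _).trans (add_le_add (hC s hs) (hD s hs))⟩

lemma sub (hf : LocallyBoundedMeasurable f) (hg : LocallyBoundedMeasurable g) :
    LocallyBoundedMeasurable fun s => f s - g s where
  aestronglyMeasurable := hf.1.sub hg.1
  exists_bound T := by
    obtain ⟨C, hC⟩ := hf.2 T
    obtain ⟨D, hD⟩ := hg.2 T
    exact ⟨C + D, fun s hs => (norm_sub_le _ _).trans (add_le_add (hC s hs) (hD s hs))⟩

lemma const_smul [NormedSpace ℝ E] (hf : LocallyBoundedMeasurable f) (a : ℝ) :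
    LocallyBoundedMeasurable fun s => a • f s where
  aestronglyMeasurable := hf.1.const_smul a
  exists_bound T := by
    obtain ⟨C, hC⟩ := hf.2 T
    exact ⟨‖a‖ * C, fun s hs => by
      rw [norm_smul]; exact mul_le_mul_of_nonneg_left (hC s hs) (norm_nonneg _)⟩

lemma const_mul {f : ℝ → ℝ} (hf : LocallyBoundedMeasurable f) (a : ℝ) :
    LocallyBoundedMeasurable fun s => a * f s := hf.const_smul a

lemma finsetSum {ι : Type*} (S : Finset ι) {F : ι → ℝ → E}
    (hF : ∀ i, LocallyBoundedMeasurable (F i)) :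
    LocallyBoundedMeasurable fun s => ∑ i ∈ S, F i s := by
  classical
  induction S using Finset.induction_on with
  | empty => simpa using of_continuousOn (f := fun _ => (0 : E)) continuousOn_const
  | insert i S hi ih =>
    simp_rw [Finset.sum_insert hi]
    exact (hF i).add ih

lemma norm_sq (hf : LocallyBoundedMeasurable f) : LocallyBoundedMeasurable fun s => ‖f s‖ ^ 2 where
  aestronglyMeasurable := hf.1.norm.pow 2
  exists_bound T := by
    obtain ⟨C, hC⟩ := hf.2 T
    exact ⟨C ^ 2, fun s hs => by
      rw [norm_pow, norm_norm]; exact pow_le_pow_left₀ (norm_nonneg _) (hC s hs) 2⟩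

lemma integrableOn (hf : LocallyBoundedMeasurable f) {a b : ℝ} (ha : 0 ≤ a) :
    IntegrableOn f (Icc a b) := by
  obtain ⟨C, hC⟩ := hf.2 b
  refine IntegrableOn.of_bound measure_Icc_lt_top
    (hf.1.mono_measure (Measure.restrict_mono (fun s hs => ha.trans hs.1) le_rfl)) C ?_
  filter_upwards [ae_restrict_mem measurableSet_Icc] with s hs
  exact hC s ⟨ha.trans hs.1, hs.2⟩

lemma intervalIntegrable (hf : LocallyBoundedMeasurable f) {a b : ℝ} (ha : 0 ≤ a) (hab : a ≤ b) :
    IntervalIntegrable f volume a b :=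
  (intervalIntegrable_iff_integrableOn_Icc_of_le hab).2 (hf.integrableOn ha)

end LocallyBoundedMeasurable

end LocallyBounded

/-! ### Open-loop predictions -/

section Predict

variable {n m : ℕ}

lemma continuous_predict {X : Type*} [TopologicalSpace X] (A : Matrix (Fin n) (Fin n) ℝ)
    {f g : X → ℝ} {v : X → EuclideanSpace ℝ (Fin n)} (hf : Continuous f) (hg : Continuous g)
    (hv : Continuous v) : Continuous fun p => predict A (f p) (g p) (v p) := by
  let _ : NormedRing (Matrix (Fin n) (Fin n) ℝ) := Matrix.linftyOpNormedRing
  let _ : NormedAlgebra ℝ (Matrix (Fin n) (Fin n) ℝ) := Matrix.linftyOpNormedAlgebra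
  let _ : NormedAlgebra ℚ (Matrix (Fin n) (Fin n) ℝ) := NormedAlgebra.restrictScalars ℚ ℝ _
  have hexp : Continuous (NormedSpace.exp : Matrix (Fin n) (Fin n) ℝ → Matrix (Fin n) (Fin n) ℝ) :=
    NormedSpace.exp_continuous
  have h : Continuous fun p => NormedSpace.exp ((g p - f p) • A) *ᵥ (v p).ofLp :=
    Continuous.matrix_mulVec (hexp.comp ((hg.sub hf).smul continuous_const))
      ((PiLp.continuous_ofLp 2 _).comp hv)
  exact (PiLp.continuous_toLp 2 _).comp h

lemma predict_self (A : Matrix (Fin n) (Fin n) ℝ) (r : ℝ) (v : EuclideanSpace ℝ (Fin n)) :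
    predict A r r v = v := by
  simp [predict, NormedSpace.exp_zero]

lemma hasDerivAt_predict (A : Matrix (Fin n) (Fin n) ℝ) (r s : ℝ)
    (v : EuclideanSpace ℝ (Fin n)) :
    HasDerivAt (fun s => predict A r s v) (Matrix.toEuclideanLin A (predict A r s v)) s := by
  let _ : NormedRing (Matrix (Fin n) (Fin n) ℝ) := Matrix.linftyOpNormedRing
  let _ : NormedAlgebra ℝ (Matrix (Fin n) (Fin n) ℝ) := Matrix.linftyOpNormedAlgebra
  let φ : Matrix (Fin n) (Fin n) ℝ →ₗ[ℝ] EuclideanSpace ℝ (Fin n) :=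
    (LinearMap.applyₗ v).comp (Matrix.toEuclideanLin (𝕜 := ℝ) (m := Fin n) (n := Fin n)).toLinearMap
  have h1 := (hasDerivAt_exp_smul_const' (𝕂 := ℝ) A (s - r)).scomp s
    ((hasDerivAt_id s).sub_const r)
  have h2 := φ.toContinuousLinearMap.hasFDerivAt.comp_hasDerivAt s h1
  refine HasDerivAt.congr_deriv (f := fun s => predict A r s v) h2 ?_
  change Matrix.toEuclideanLin ((1 : ℝ) • (A * NormedSpace.exp ((s - r) • A))) v = _
  simp [predict, Matrix.toLpLin_apply, Matrix.mulVec_mulVec]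

end Predict

/-! ### Response to an input of finite energy -/

section Gronwall

variable {E : Type*} [NormedAddCommGroup E] [InnerProductSpace ℝ E]

/-- Energy form of Gronwall's inequality: the response of `ε' = A ε + B q`, `ε r = 0`, is controlled
by the energy of the input `q`. -/
lemma norm_sq_le_integral_input {A B : E →L[ℝ] E} {ε q : ℝ → E} {r T : ℝ} (hrT : r ≤ T)
    (hε : ContinuousOn ε (Icc r T)) (h0 : ε r = 0)
    (hderiv : ∀ s ∈ Ioo r T, HasDerivWithinAt ε (A (ε s) + B (q s)) (Ioi s) s)
    (hq : IntegrableOn (fun s => ‖q s‖ ^ 2) (Icc r T)) :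
    ‖ε T‖ ^ 2 ≤ Real.exp ((2 * ‖A‖ + 1) * (T - r)) * ‖B‖ ^ 2 * ∫ s in r..T, ‖q s‖ ^ 2 := by
  set a := 2 * ‖A‖ + 1 with ha
  have ha0 : 0 ≤ a := by positivity
  have key := intervalIntegral.sub_le_integral_of_hasDeriv_right_of_le
    (g := fun s => Real.exp (-(a * (s - r))) * ‖ε s‖ ^ 2)
    (g' := fun s => -a * Real.exp (-(a * (s - r))) * ‖ε s‖ ^ 2
      + Real.exp (-(a * (s - r))) * (2 * inner ℝ (ε s) (A (ε s) + B (q s))))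
    (φ := fun s => ‖B‖ ^ 2 * ‖q s‖ ^ 2) hrT
    (ContinuousOn.mul (by fun_prop) (hε.norm.pow 2)) ?_ (hq.const_mul _) ?_
  · rw [intervalIntegral.integral_const_mul] at key
    simp only [h0, norm_zero] at key
    have h1 := mul_le_mul_of_nonneg_left key (Real.exp_pos (a * (T - r))).le
    have h2 : Real.exp (a * (T - r)) * Real.exp (-(a * (T - r))) = 1 := by
      rw [← Real.exp_add]; simp
    calc ‖ε T‖ ^ 2 = Real.exp (a * (T - r)) * Real.exp (-(a * (T - r))) * ‖ε T‖ ^ 2 := by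
          rw [h2, one_mul]
      _ ≤ _ := by linarith
  · intro s hs
    have h1 : HasDerivAt (fun s => Real.exp (-(a * (s - r))))
        (-a * Real.exp (-(a * (s - r)))) s := by
      have := (((hasDerivAt_id s).sub_const r).const_mul a).neg.exp
      simpa [mul_comm] using this
    exact h1.hasDerivWithinAt.mul (hderiv s hs).norm_sq
  · intro s hs
    have h1 : inner ℝ (ε s) (A (ε s)) ≤ ‖A‖ * ‖ε s‖ ^ 2 := by
      refine (real_inner_le_norm _ _).trans ?_
      have := mul_le_mul_of_nonneg_left (A.le_opNorm (ε s)) (norm_nonneg (ε s))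
      linarith
    have h2 : 2 * inner ℝ (ε s) (B (q s)) ≤ ‖ε s‖ ^ 2 + ‖B‖ ^ 2 * ‖q s‖ ^ 2 := by
      have h3 := (real_inner_le_norm (ε s) (B (q s))).trans
        (mul_le_mul_of_nonneg_left (B.le_opNorm (q s)) (norm_nonneg (ε s)))
      nlinarith [sq_nonneg (‖ε s‖ - ‖B‖ * ‖q s‖)]
    have h4 : Real.exp (-(a * (s - r))) ≤ 1 :=
      Real.exp_le_one_iff.2 (neg_nonpos.2 (mul_nonneg ha0 (sub_nonneg.2 hs.1.le)))
    rw [inner_add_right]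
    calc _ = Real.exp (-(a * (s - r))) * (2 * inner ℝ (ε s) (A (ε s))
            + 2 * inner ℝ (ε s) (B (q s)) - a * ‖ε s‖ ^ 2) := by ring
      _ ≤ Real.exp (-(a * (s - r))) * (‖B‖ ^ 2 * ‖q s‖ ^ 2) := by
          refine mul_le_mul_of_nonneg_left ?_ (Real.exp_pos _).le
          rw [ha]; linarith
      _ ≤ 1 * (‖B‖ ^ 2 * ‖q s‖ ^ 2) := mul_le_mul_of_nonneg_right h4 (by positivity)
      _ = _ := one_mul _

lemma integral_norm_sq_le_integral_input {A B : E →L[ℝ] E} {ε q : ℝ → E} {r T : ℝ} (hrT : r ≤ T)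
    (hε : ContinuousOn ε (Icc r T)) (h0 : ε r = 0)
    (hderiv : ∀ s ∈ Ioo r T, HasDerivWithinAt ε (A (ε s) + B (q s)) (Ioi s) s)
    (hq : IntegrableOn (fun s => ‖q s‖ ^ 2) (Icc r T)) :
    ∫ s in r..T, ‖ε s‖ ^ 2 ≤
      (T - r) * (Real.exp ((2 * ‖A‖ + 1) * (T - r)) * ‖B‖ ^ 2) * ∫ s in r..T, ‖q s‖ ^ 2 := by
  have hqi := (intervalIntegrable_iff_integrableOn_Icc_of_le hrT).2 hq
  have hle : ∀ s ∈ Icc r T, ‖ε s‖ ^ 2 ≤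
      Real.exp ((2 * ‖A‖ + 1) * (T - r)) * ‖B‖ ^ 2 * ∫ s in r..T, ‖q s‖ ^ 2 := by
    intro s hs
    refine (norm_sq_le_integral_input hs.1 (hε.mono (Icc_subset_Icc_right hs.2)) h0
      (fun u hu => hderiv u ⟨hu.1, hu.2.trans_le hs.2⟩)
      (hq.mono_set (Icc_subset_Icc_right hs.2))).trans ?_
    refine mul_le_mul ?_ ?_ (intervalIntegral.integral_nonneg hs.1 fun _ _ => by positivity)
      (by positivity)
    · refine mul_le_mul_of_nonneg_right (Real.exp_le_exp.2 ?_) (by positivity)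
      exact mul_le_mul_of_nonneg_left (by linarith [hs.2]) (by positivity)
    · exact intervalIntegral.integral_mono_interval le_rfl hs.1 hs.2
        (Eventually.of_forall fun _ => by positivity) hqi
  have := intervalIntegral.integral_mono_on (μ := volume) hrT
    ((hε.norm.pow 2).intervalIntegrable_of_Icc hrT) intervalIntegrable_const hle
  rw [intervalIntegral.integral_const, smul_eq_mul, ← mul_assoc] at this
  exact this

end Gronwall

/-! ### Convergence of a dissipated energy -/

section Dissipation

/-- A nonnegative function `V ≤ p Y` with `V' ≤ -b Y + e / c` tends to zero, if the total disturbance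
`∫ e` is at most `θ ∫ Y` up to a constant and the feedback gain `θ / c` is less than `b`. -/
lemma tendsto_zero_of_dissipation {V Y e : ℝ → ℝ} {p b c θ C : ℝ} (hp : 0 < p) (hc : 0 < c)
    (hb : 0 < b) (hgain : θ / c < b) (hV : ∀ s, 0 ≤ s → 0 ≤ V s)
    (hY : ∀ s, 0 ≤ s → 0 ≤ Y s) (he : ∀ s, 0 ≤ s → 0 ≤ e s)
    (hYint : ∀ s T, 0 ≤ s → s ≤ T → IntervalIntegrable Y volume s T)
    (heint : ∀ s T, 0 ≤ s → s ≤ T → IntervalIntegrable e volume s T)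
    (hVY : ∀ s, 0 ≤ s → V s ≤ p * Y s)
    (hdiss : ∀ s T, 0 ≤ s → s ≤ T → V T - V s ≤ ∫ u in s..T, (-b * Y u + 1 / c * e u))
    (hedom : ∀ T, 0 ≤ T → ∫ u in (0 : ℝ)..T, e u ≤ θ * (∫ u in (0 : ℝ)..T, Y u) + C) :
    Tendsto V atTop (𝓝 0) := by
  have hdiss' : ∀ s T, 0 ≤ s → s ≤ T →
      V T - V s ≤ -b * (∫ u in s..T, Y u) + 1 / c * ∫ u in s..T, e u := by
    intro s T hs hsT
    have := hdiss s T hs hsT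
    rwa [intervalIntegral.integral_add ((hYint s T hs hsT).const_mul _)
      ((heint s T hs hsT).const_mul _), intervalIntegral.integral_const_mul,
      intervalIntegral.integral_const_mul] at this
  set J : ℝ → ℝ := fun T => ∫ u in (0 : ℝ)..(max T 0), e u with hJ
  have hadd : ∀ f : ℝ → ℝ, (∀ s T, 0 ≤ s → s ≤ T → IntervalIntegrable f volume s T) →
      ∀ s T, 0 ≤ s → s ≤ T → ∫ u in (0 : ℝ)..T, f u
        = (∫ u in (0 : ℝ)..s, f u) + ∫ u in s..T, f u := fun f hf s T hs hsT =>
    (intervalIntegral.integral_add_adjacent_intervals (hf 0 s le_rfl hs) (hf s T hs hsT)).symm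
  set R := (V 0 + C / c) / (b - θ / c) with hR
  have hYb : ∀ T, 0 ≤ T → ∫ u in (0 : ℝ)..T, Y u ≤ R := by
    intro T hT
    rw [hR, le_div_iff₀ (by linarith)]
    have h1 := hdiss' 0 T le_rfl hT
    have h2 := mul_le_mul_of_nonneg_left (hedom T hT) (one_div_pos.2 hc).le
    have h3 : 1 / c * (θ * (∫ u in (0 : ℝ)..T, Y u) + C)
        = θ / c * (∫ u in (0 : ℝ)..T, Y u) + C / c := by ring
    linarith [hV T hT]
  have hJmono : Monotone J := by
    intro s T hsT
    have h1 : (0 : ℝ) ≤ max s 0 := le_max_right _ _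
    have h2 : max s 0 ≤ max T 0 := max_le_max_right 0 hsT
    simp only [hJ]
    rw [hadd e heint _ _ h1 h2]
    exact le_add_of_nonneg_right
      (intervalIntegral.integral_nonneg h2 fun u hu => he u (h1.trans hu.1))
  have hJbdd : BddAbove (range J) := by
    refine ⟨|θ| * R + C, ?_⟩
    rintro _ ⟨T, rfl⟩
    have hT : (0 : ℝ) ≤ max T 0 := le_max_right _ _
    have hY0 : 0 ≤ ∫ u in (0 : ℝ)..(max T 0), Y u :=
      intervalIntegral.integral_nonneg hT fun u hu => hY u hu.1
    refine (hedom _ hT).trans (add_le_add ?_ le_rfl)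
    exact (mul_le_mul_of_nonneg_right (le_abs_self θ) hY0).trans
      (mul_le_mul_of_nonneg_left (hYb _ hT) (abs_nonneg θ))
  have hJlim := tendsto_atTop_ciSup hJmono hJbdd
  rw [Metric.tendsto_atTop]
  intro δ hδ
  obtain ⟨S₀, hS₀⟩ := (hJlim.eventually
    (lt_mem_nhds (sub_lt_self (⨆ T, J T) (show 0 < c * (δ / 2) by positivity)))).exists_forall_of_atTop
  set S := max S₀ 0 with hS
  have hS0 : (0 : ℝ) ≤ S := le_max_right _ _
  -- `V` cannot stay above `δ / 2`, because `Y ≥ V / p` has a finite integral.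
  obtain ⟨s, hSs, hVs⟩ : ∃ s, S ≤ s ∧ V s < δ / 2 := by
    by_contra! hcon
    set T := S + (R + 1) / (δ / 2 / p) with hT
    have hR0 : 0 ≤ R := by simpa using hYb 0 le_rfl
    have hST : S ≤ T := by rw [hT]; exact le_add_of_nonneg_right (by positivity)
    have h1 := intervalIntegral.integral_mono_on hST
      (intervalIntegrable_const (c := δ / 2 / p)) (hYint S T hS0 hST) (fun u hu => by
        rw [div_le_iff₀ hp, mul_comm]
        exact (hcon u hu.1).trans (hVY u (hS0.trans hu.1)))
    rw [intervalIntegral.integral_const, smul_eq_mul] at h1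
    have h2 : (T - S) * (δ / 2 / p) = R + 1 := by rw [hT]; field_simp; ring
    have h3 := hYb T (hS0.trans hST)
    rw [hadd Y hYint S T hS0 hST] at h3
    have h4 : 0 ≤ ∫ u in (0 : ℝ)..S, Y u :=
      intervalIntegral.integral_nonneg hS0 fun u hu => hY u hu.1
    linarith
  refine ⟨s, fun T hT => ?_⟩
  have hs0 := hS0.trans hSs
  rw [Real.dist_eq, sub_zero, abs_of_nonneg (hV T (hs0.trans hT))]
  have h1 := hdiss' s T hs0 hT
  have h2 : 0 ≤ b * ∫ u in s..T, Y u :=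
    mul_nonneg hb.le (intervalIntegral.integral_nonneg hT fun u hu => hY u (hs0.trans hu.1))
  have h3 : ∫ u in s..T, e u < c * (δ / 2) := by
    have h4 := hS₀ s ((le_max_left _ _).trans hSs)
    have h5 := le_ciSup hJbdd T
    simp only [hJ, max_eq_left hs0] at h4
    simp only [hJ, max_eq_left (hs0.trans hT)] at h5
    rw [hadd e heint s T hs0 hT] at h5
    linarith
  have h6 : 1 / c * ∫ u in s..T, e u < δ / 2 := by
    rw [one_div, inv_mul_lt_iff₀ hc]; exact h3
  linarith

end Dissipation

/-! ### Triggering instants and the minimum inter-event time -/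

section Trajectory

variable {N n m : ℕ}

/-- The gauged relative estimate `∑ⱼ |w i j| (ẑᵢ - ẑⱼ)`, `ẑᵢ = σᵢ x̂ᵢ`, of agent `i`. -/
noncomputable def relEstimate (G : SignedGraph N) (σ : Fin N → ℝ) (A : Matrix (Fin n) (Fin n) ℝ)
    (x : Fin N → ℝ → EuclideanSpace ℝ (Fin n)) (t : Fin N → ℕ → EReal) (i : Fin N) (s : ℝ) :
    EuclideanSpace ℝ (Fin n) :=
  ∑ j, |G.w i j| • (σ i • estimate A x t i s - σ j • estimate A x t j s)

/-- The gauged sampling error `ẑᵢ - zᵢ`, `zᵢ = σᵢ xᵢ`, of agent `i`. -/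
noncomputable def samplingError (σ : Fin N → ℝ) (A : Matrix (Fin n) (Fin n) ℝ)
    (x : Fin N → ℝ → EuclideanSpace ℝ (Fin n)) (t : Fin N → ℕ → EReal) (i : Fin N) (s : ℝ) :
    EuclideanSpace ℝ (Fin n) :=
  σ i • estimate A x t i s - σ i • x i s

lemma sigma_smul_controlInput {G : SignedGraph N} {σ : Fin N → ℝ} (hσ : G.IsGauge σ)
    (A : Matrix (Fin n) (Fin n) ℝ) (K : Matrix (Fin m) (Fin n) ℝ)
    (x : Fin N → ℝ → EuclideanSpace ℝ (Fin n)) (t : Fin N → ℕ → EReal) (i : Fin N) (s : ℝ) :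
    σ i • controlInput G A K x t i s = -Matrix.toEuclideanLin K (relEstimate G σ A x t i s) := by
  rw [controlInput, relEstimate, smul_neg, ← map_smul, Finset.smul_sum]
  congr 2
  refine Finset.sum_congr rfl fun j _ => ?_
  rw [smul_comm, smul_sub, smul_sub, smul_sub, smul_smul (σ i) (Real.sign _), smul_smul _ (_ * _),
    hσ.abs_weight_mul_sign, ← smul_smul]

section LastTrigger

variable {t : ℕ → EReal}

lemma zero_mem_lastTrigger_set (h0 : t 0 = 0) {s : ℝ} (hs : 0 ≤ s) :
    (0 : ℝ) ∈ {r : ℝ | r ≤ s ∧ ∃ l, t l = (r : EReal)} := ⟨hs, 0, by simpa using h0⟩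

lemma bddAbove_lastTrigger_set (t : ℕ → EReal) (s : ℝ) :
    BddAbove {r : ℝ | r ≤ s ∧ ∃ l, t l = (r : EReal)} := ⟨s, fun _ h => h.1⟩

lemma lastTrigger_nonneg (h0 : t 0 = 0) {s : ℝ} (hs : 0 ≤ s) : 0 ≤ lastTrigger t s :=
  le_csSup (bddAbove_lastTrigger_set t s) (zero_mem_lastTrigger_set h0 hs)

lemma lastTrigger_le (h0 : t 0 = 0) {s : ℝ} (hs : 0 ≤ s) : lastTrigger t s ≤ s :=
  csSup_le ⟨0, zero_mem_lastTrigger_set h0 hs⟩ fun _ h => h.1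

lemma lastTrigger_mono (h0 : t 0 = 0) {s s' : ℝ} (hs : 0 ≤ s) (hss' : s ≤ s') :
    lastTrigger t s ≤ lastTrigger t s' :=
  csSup_le_csSup (bddAbove_lastTrigger_set t s') ⟨0, zero_mem_lastTrigger_set h0 hs⟩
    fun _ h => ⟨h.1.trans hss', h.2⟩

lemma lastTrigger_eq (ht : Monotone t) {k : ℕ} {r s : ℝ} (hr : t k = (r : EReal)) (hrs : r ≤ s)
    (hs : (s : EReal) < t (k + 1)) : lastTrigger t s = r := by
  refine le_antisymm (csSup_le ⟨r, hrs, k, hr⟩ ?_)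
    (le_csSup (bddAbove_lastTrigger_set t s) ⟨hrs, k, hr⟩)
  rintro u ⟨hus, l, hl⟩
  rcases Nat.lt_or_ge k l with hkl | hkl
  · have h1 := hs.trans_le (ht (Nat.succ_le_of_lt hkl))
    rw [hl, EReal.coe_lt_coe_iff] at h1
    exact absurd hus (not_le.2 h1)
  · have h1 := ht hkl
    rwa [hl, hr, EReal.coe_le_coe_iff] at h1

/-- The estimates are measurable, since the last triggering instant is a monotone function of time,
and they are bounded on compact intervals because it lies between `0` and the current time. -/
lemma locallyBoundedMeasurable_estimate (A : Matrix (Fin n) (Fin n) ℝ)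
    {x : Fin N → ℝ → EuclideanSpace ℝ (Fin n)} {t : Fin N → ℕ → EReal} {i : Fin N}
    (hx : ContinuousOn (x i) (Ici 0)) (h0 : t i 0 = 0) :
    LocallyBoundedMeasurable (estimate A x t i) := by
  have hx' : Continuous fun r : ℝ => x i (max r 0) :=
    hx.comp_continuous (by fun_prop) fun r => le_max_right r 0
  have hF : Continuous fun p : ℝ × ℝ => predict A p.1 p.2 (x i (max p.1 0)) :=
    continuous_predict A continuous_fst continuous_snd (hx'.comp continuous_fst)
  have hmono : Monotone fun s : ℝ => lastTrigger (t i) (max s 0) := fun s s' hss' =>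
    lastTrigger_mono h0 (le_max_right _ _) (max_le_max_right 0 hss')
  have heq : ∀ s : ℝ, 0 ≤ s → estimate A x t i s
      = predict A (lastTrigger (t i) s) s (x i (max (lastTrigger (t i) s) 0)) := fun s hs => by
    rw [max_eq_left (lastTrigger_nonneg h0 hs), estimate]
  constructor
  · have hm := hF.measurable.comp (hmono.measurable.prodMk measurable_id)
    refine hm.aestronglyMeasurable.congr ?_
    filter_upwards [ae_restrict_mem measurableSet_Ici] with s hs
    rw [heq s hs]
    simp only [Function.comp, id, max_eq_left (mem_Ici.1 hs)]
  · intro T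
    obtain ⟨C, hC⟩ := (isCompact_Icc (a := (0 : ℝ)) (b := T)).prod
      (isCompact_Icc (a := (0 : ℝ)) (b := T)) |>.exists_bound_of_continuousOn hF.continuousOn
    refine ⟨C, fun s hs => ?_⟩
    rw [heq s hs.1]
    exact hC (lastTrigger (t i) s, s) ⟨⟨lastTrigger_nonneg h0 hs.1,
      (lastTrigger_le h0 hs.1).trans hs.2⟩, hs⟩

end LastTrigger

namespace IsTrajectory

variable {G : SignedGraph N} {σ : Fin N → ℝ} {A : Matrix (Fin n) (Fin n) ℝ}
  {B : Matrix (Fin n) (Fin m) ℝ} {K : Matrix (Fin m) (Fin n) ℝ} {β : Fin N → ℝ} {h : ℝ → ℝ}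
  {x : Fin N → ℝ → EuclideanSpace ℝ (Fin n)} {t : Fin N → ℕ → EReal}

lemma monotone_trigger (H : IsTrajectory G σ A B K β h x t) (i : Fin N) : Monotone (t i) := by
  refine monotone_nat_of_le_succ fun k => ?_
  rw [H.next_trigger]
  refine le_sInf ?_
  rintro T ⟨s, rfl, hs, -⟩
  exact hs.le

lemma trigger_nonneg (H : IsTrajectory G σ A B K β h x t) (i : Fin N) (k : ℕ) : 0 ≤ t i k := by
  rw [← H.first_trigger i]; exact H.monotone_trigger i (Nat.zero_le k)

lemma trigger_eq_top_or_coe (H : IsTrajectory G σ A B K β h x t) (i : Fin N) (k : ℕ) :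
    t i k = ⊤ ∨ ∃ r : ℝ, 0 ≤ r ∧ t i k = (r : EReal) := by
  have h0 := H.trigger_nonneg i k
  induction hT : t i k using EReal.rec with
  | bot => rw [hT] at h0; simp at h0
  | coe r => exact Or.inr ⟨r, by rw [hT] at h0; exact_mod_cast h0, rfl⟩
  | top => exact Or.inl rfl

lemma trigger_succ_eq_top (H : IsTrajectory G σ A B K β h x t) {i : Fin N} {k : ℕ}
    (hk : t i k = ⊤) : t i (k + 1) = ⊤ :=
  top_le_iff.1 (hk ▸ H.monotone_trigger i (Nat.le_succ k))

lemma triggerFunction_nonpos (H : IsTrajectory G σ A B K β h x t) {i : Fin N} {k : ℕ} {s : ℝ}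
    (hk : t i k < (s : EReal)) (hs : (s : EReal) < t i (k + 1)) :
    triggerFunction G σ A β h x t i k s ≤ 0 := by
  by_contra! hpos
  rw [H.next_trigger] at hs
  exact hs.not_ge (sInf_le ⟨s, rfl, hk, hpos⟩)

lemma estimate_eq (H : IsTrajectory G σ A B K β h x t) {i : Fin N} {k : ℕ} {r s : ℝ}
    (hr : t i k = (r : EReal)) (hrs : r ≤ s) (hs : (s : EReal) < t i (k + 1)) :
    estimate A x t i s = predict A r s (x i r) := by
  rw [estimate, lastTrigger_eq (H.monotone_trigger i) hr hrs hs]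

lemma locallyBounded_state (H : IsTrajectory G σ A B K β h x t) (i : Fin N) :
    LocallyBoundedMeasurable (x i) :=
  .of_continuousOn (H.continuousOn i)

lemma locallyBounded_estimate (H : IsTrajectory G σ A B K β h x t) (i : Fin N) :
    LocallyBoundedMeasurable (estimate A x t i) :=
  locallyBoundedMeasurable_estimate A (H.continuousOn i) (H.first_trigger i)

lemma locallyBounded_relEstimate (H : IsTrajectory G σ A B K β h x t) (i : Fin N) :
    LocallyBoundedMeasurable (relEstimate G σ A x t i) :=
  .finsetSum _ fun j => (((H.locallyBounded_estimate i).const_smul (σ i)).sub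
    ((H.locallyBounded_estimate j).const_smul (σ j))).const_smul _

lemma locallyBounded_samplingError (H : IsTrajectory G σ A B K β h x t) (i : Fin N) :
    LocallyBoundedMeasurable (samplingError σ A x t i) :=
  ((H.locallyBounded_estimate i).const_smul (σ i)).sub ((H.locallyBounded_state i).const_smul (σ i))

lemma continuousOn_heldError (H : IsTrajectory G σ A B K β h x t) (i : Fin N) (r : ℝ) :
    ContinuousOn (fun s => σ i • predict A r s (x i r) - σ i • x i s) (Ici 0) := by
  have h1 : Continuous fun s => predict A r s (x i r) :=
    continuous_predict A (f := fun _ => r) (g := fun s => s) (v := fun _ => x i r)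
      continuous_const continuous_id continuous_const
  exact (h1.const_smul (σ i)).continuousOn.sub ((H.continuousOn i).const_smul (σ i))

lemma locallyBounded_triggerIntegrand (H : IsTrajectory G σ A B K β h x t)
    (hcont : ContinuousOn h (Ici 0)) (i : Fin N) (r : ℝ) :
    LocallyBoundedMeasurable (triggerIntegrand G σ A β h x t i r) := by
  have h1 : LocallyBoundedMeasurable fun s => predict A r s (x i r) :=
    .of_continuousOn (continuous_predict A (f := fun _ => r) (g := fun s => s)
      (v := fun _ => x i r) continuous_const continuous_id continuous_const).continuousOn
  exact ((LocallyBoundedMeasurable.of_continuousOn (H.continuousOn_heldError i r)).norm_sq.sub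
    ((LocallyBoundedMeasurable.finsetSum _ fun j => ((h1.const_smul (σ i)).sub
      ((H.locallyBounded_estimate j).const_smul (σ j))).const_smul |G.w i j|).norm_sq.const_mul
        (β i))).sub
    ((LocallyBoundedMeasurable.of_continuousOn hcont).const_mul (β i))

/-- The integrand of the triggering function for the estimates that enter the control. -/
lemma triggerIntegrand_eq (H : IsTrajectory G σ A B K β h x t) {i : Fin N} {k : ℕ} {r s : ℝ}
    (hr : t i k = (r : EReal)) (hrs : r ≤ s) (hs : (s : EReal) < t i (k + 1)) :
    triggerIntegrand G σ A β h x t i r s = ‖samplingError σ A x t i s‖ ^ 2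
      - β i * ‖relEstimate G σ A x t i s‖ ^ 2 - β i * h s := by
  rw [triggerIntegrand, samplingError, relEstimate, H.estimate_eq hr hrs hs]

lemma continuousOn_triggerFunction (H : IsTrajectory G σ A B K β h x t)
    (hcont : ContinuousOn h (Ici 0)) {i : Fin N} {k : ℕ} {r T : ℝ} (hr : t i k = (r : EReal))
    (hr0 : 0 ≤ r) (hrT : r ≤ T) :
    ContinuousOn (triggerFunction G σ A β h x t i k) (Icc r T) := by
  have h1 := intervalIntegral.continuousOn_primitive_interval (μ := volume)
    (f := triggerIntegrand G σ A β h x t i r) (a := r) (b := T)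
    (by rw [uIcc_of_le hrT]; exact (H.locallyBounded_triggerIntegrand hcont i r).integrableOn hr0)
  rw [uIcc_of_le hrT] at h1
  refine h1.congr fun s _ => ?_
  rw [triggerFunction, hr, EReal.toReal_coe]

/-- Equation of motion of the gauged states. -/
lemma hasDerivWithinAt_gauged (H : IsTrajectory G σ A B K β h x t) (hσ : G.IsGauge σ) (i : Fin N)
    {s : ℝ} (hs : 0 ≤ s) :
    HasDerivWithinAt (fun s => σ i • x i s)
      (Matrix.toEuclideanLin A (σ i • x i s)
        - Matrix.toEuclideanLin (B * K) (relEstimate G σ A x t i s)) (Ici s) s := by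
  refine ((H.dynamics i s hs).const_smul (σ i)).congr_deriv ?_
  rw [smul_add, ← map_smul, ← map_smul, sigma_smul_controlInput hσ, map_neg, ← sub_eq_add_neg]
  simp [Matrix.toLpLin_apply, Matrix.mulVec_mulVec]

/-- The error `ε` of a sample held from time `r` on satisfies `ε' = A ε + B K q`, `ε r = 0`, where `q`
is the relative estimate, so that its energy is small compared with that of `q` on a short
interval. -/
lemma integral_heldError_le (H : IsTrajectory G σ A B K β h x t) (hσ : G.IsGauge σ) (i : Fin N)
    {r T : ℝ} (hr0 : 0 ≤ r) (hrT : r ≤ T) :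
    ∫ s in r..T, ‖σ i • predict A r s (x i r) - σ i • x i s‖ ^ 2 ≤
      (T - r) * (Real.exp ((2 * opNorm A + 1) * (T - r)) * opNorm (B * K) ^ 2)
        * ∫ s in r..T, ‖relEstimate G σ A x t i s‖ ^ 2 := by
  refine integral_norm_sq_le_integral_input (A := Matrix.toEuclideanCLM (𝕜 := ℝ) A)
    (B := Matrix.toEuclideanCLM (𝕜 := ℝ) (B * K)) hrT
    ((H.continuousOn_heldError i r).mono fun s hs => hr0.trans hs.1)
    (by rw [predict_self, sub_self]) ?_ ((H.locallyBounded_relEstimate i).norm_sq.integrableOn hr0)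
  intro s hs
  have h1 := ((hasDerivAt_predict A r s (x i r)).const_smul (σ i)).hasDerivWithinAt (s := Ioi s)
  have h2 := (H.hasDerivWithinAt_gauged hσ i (hr0.trans hs.1.le)).mono Ioi_subset_Ici_self
  refine (h1.sub h2).congr_deriv ?_
  change _ = Matrix.toEuclideanLin A _ + Matrix.toEuclideanLin (B * K) _
  rw [map_sub, map_smul, map_smul]
  abel

/-- No event is due right after a triggering instant: the sampling error starts from zero, and the
term `β h` of the threshold is positive. -/
lemma exists_triggerFunction_nonpos_right (H : IsTrajectory G σ A B K β h x t)
    (hcont : ContinuousOn h (Ici 0)) (hpos : ∀ s, 0 ≤ s → 0 < h s) (hβ : ∀ i, 0 < β i)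
    {i : Fin N} {k : ℕ} {r : ℝ} (hr : t i k = (r : EReal)) (hr0 : 0 ≤ r) :
    ∃ δ > r, ∀ s ∈ Ioo r δ, triggerFunction G σ A β h x t i k s ≤ 0 := by
  have hc : ContinuousWithinAt
      (fun s => ‖σ i • predict A r s (x i r) - σ i • x i s‖ ^ 2 - β i * h s) (Ici r) r :=
    (((H.continuousOn_heldError i r).norm.pow 2).sub (hcont.const_mul _) r hr0).mono
      (Ici_subset_Ici.2 hr0)
  have hneg : ∀ᶠ s in 𝓝[≥] r,
      ‖σ i • predict A r s (x i r) - σ i • x i s‖ ^ 2 - β i * h s < 0 := by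
    refine hc.eventually (Iio_mem_nhds ?_)
    have := mul_pos (hβ i) (hpos r hr0)
    simpa [predict_self] using this
  obtain ⟨δ, hδ, hsub⟩ := mem_nhdsGE_iff_exists_Ico_subset.1 hneg
  refine ⟨δ, hδ, fun s hs => ?_⟩
  rw [triggerFunction, hr, EReal.toReal_coe]
  refine (intervalIntegral.integral_mono_on (g := fun _ => (0 : ℝ)) hs.1.le
    ((H.locallyBounded_triggerIntegrand hcont i r).intervalIntegrable hr0 hs.1.le)
    intervalIntegrable_const ?_).trans (by simp)
  intro u hu
  have h1 : ‖σ i • predict A r u (x i r) - σ i • x i u‖ ^ 2 - β i * h u < 0 :=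
    hsub ⟨hu.1, hu.2.trans_lt hs.2⟩
  have h2 : 0 ≤ β i * ‖∑ j,
      |G.w i j| • (σ i • predict A r u (x i r) - σ j • estimate A x t j u)‖ ^ 2 :=
    mul_nonneg (hβ i).le (by positivity)
  rw [triggerIntegrand]
  linarith

lemma triggerFunction_eq (H : IsTrajectory G σ A B K β h x t) {i : Fin N}
    {k : ℕ} {r T : ℝ} (hr : t i k = (r : EReal)) (hrT : r ≤ T) (hT : (T : EReal) ≤ t i (k + 1)) :
    triggerFunction G σ A β h x t i k T = ∫ s in r..T, (‖samplingError σ A x t i s‖ ^ 2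
      - β i * ‖relEstimate G σ A x t i s‖ ^ 2 - β i * h s) := by
  rw [triggerFunction, hr, EReal.toReal_coe]
  -- At the endpoint `T` the estimate may already use a new sample, but one instant is null.
  refine intervalIntegral.integral_congr_ae ?_
  filter_upwards [Measure.ae_ne volume T] with s hsT hs
  rw [uIoc_of_le hrT] at hs
  exact H.triggerIntegrand_eq hr hs.1.le
    (lt_of_lt_of_le (EReal.coe_lt_coe_iff.2 (lt_of_le_of_ne hs.2 hsT)) hT)

lemma triggerFunction_neg (H : IsTrajectory G σ A B K β h x t) (hσ : G.IsGauge σ)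
    (hcont : ContinuousOn h (Ici 0)) (hpos : ∀ s, 0 ≤ s → 0 < h s) (hβ : ∀ i, 0 < β i)
    {τ : ℝ} (hτ : ∀ i, τ * (Real.exp ((2 * opNorm A + 1) * τ) * opNorm (B * K) ^ 2) ≤ β i)
    {i : Fin N} {k : ℕ} {r T : ℝ} (hr : t i k = (r : EReal)) (hr0 : 0 ≤ r) (hrT : r < T)
    (hTτ : T ≤ r + τ) (hT : (T : EReal) ≤ t i (k + 1)) :
    triggerFunction G σ A β h x t i k T < 0 := by
  have herr := (H.locallyBounded_samplingError i).norm_sq.intervalIntegrable hr0 hrT.le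
  have hrel := ((H.locallyBounded_relEstimate i).norm_sq.intervalIntegrable hr0 hrT.le)
  have hh : IntervalIntegrable h volume r T :=
    (LocallyBoundedMeasurable.of_continuousOn hcont).intervalIntegrable hr0 hrT.le
  rw [H.triggerFunction_eq hr hrT.le hT, intervalIntegral.integral_sub
    (herr.sub (hrel.const_mul _)) (hh.const_mul _), intervalIntegral.integral_sub herr
    (hrel.const_mul _), intervalIntegral.integral_const_mul, intervalIntegral.integral_const_mul]
  have h1 : 0 < ∫ s in r..T, h s := intervalIntegral.intervalIntegral_pos_of_pos_on hh
    (fun s hs => hpos s (hr0.trans hs.1.le)) hrT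
  have h2 : ∫ s in r..T, ‖samplingError σ A x t i s‖ ^ 2
      = ∫ s in r..T, ‖σ i • predict A r s (x i r) - σ i • x i s‖ ^ 2 := by
    refine intervalIntegral.integral_congr_ae ?_
    filter_upwards [Measure.ae_ne volume T] with s hsT hs
    rw [uIoc_of_le hrT.le] at hs
    rw [samplingError, H.estimate_eq hr hs.1.le
      (lt_of_lt_of_le (EReal.coe_lt_coe_iff.2 (lt_of_le_of_ne hs.2 hsT)) hT)]
  have h3 := H.integral_heldError_le hσ i hr0 hrT.le
  have h4 : (T - r) * (Real.exp ((2 * opNorm A + 1) * (T - r)) * opNorm (B * K) ^ 2) ≤ β i := by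
    refine le_trans ?_ (hτ i)
    have hA : 0 ≤ opNorm A := norm_nonneg _
    have hle : T - r ≤ τ := by linarith
    have h0 : 0 ≤ T - r := by linarith
    have hτ0 : 0 ≤ τ := h0.trans hle
    gcongr
  have h5 : 0 ≤ ∫ s in r..T, ‖relEstimate G σ A x t i s‖ ^ 2 :=
    intervalIntegral.integral_nonneg hrT.le fun _ _ => by positivity
  have h6 := mul_le_mul_of_nonneg_right h4 h5
  have h7 := mul_pos (hβ i) h1
  rw [h2]
  linarith

/-- The minimum inter-event time. An event at a time `T` before `t k + τ` would require positive
values of the triggering function arbitrarily close to the right of `T`; this is excluded by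
continuity, as the triggering function is negative at `T`, or has `T = t k` as its starting point. -/
lemma trigger_add_le (H : IsTrajectory G σ A B K β h x t) (hσ : G.IsGauge σ)
    (hcont : ContinuousOn h (Ici 0)) (hpos : ∀ s, 0 ≤ s → 0 < h s) (hβ : ∀ i, 0 < β i)
    {τ : ℝ} (hτ : ∀ i, τ * (Real.exp ((2 * opNorm A + 1) * τ) * opNorm (B * K) ^ 2) ≤ β i)
    (i : Fin N) (k : ℕ) : t i k + (τ : EReal) ≤ t i (k + 1) := by
  rcases H.trigger_eq_top_or_coe i k with hk | ⟨r, hr0, hr⟩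
  · rw [H.trigger_succ_eq_top hk]; exact le_top
  by_contra! hlt
  rcases H.trigger_eq_top_or_coe i (k + 1) with hk' | ⟨T, hT0, hT⟩
  · rw [hk'] at hlt; exact not_top_lt hlt
  have hrT : r ≤ T := by
    have := H.monotone_trigger i (Nat.le_succ k)
    rwa [Nat.succ_eq_add_one, hT, hr, EReal.coe_le_coe_iff] at this
  have hTτ : T < r + τ := by
    rw [hT, hr, ← EReal.coe_add, EReal.coe_lt_coe_iff] at hlt; exact hlt
  obtain ⟨δ, hδ, hδf⟩ : ∃ δ > T, ∀ s ∈ Ioo T δ, triggerFunction G σ A β h x t i k s ≤ 0 := by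
    rcases hrT.eq_or_lt with rfl | hrT'
    · exact H.exists_triggerFunction_nonpos_right hcont hpos hβ hr hr0
    · have hneg := H.triggerFunction_neg hσ hcont hpos hβ hτ hr hr0 hrT' hTτ.le hT.ge
      have hc := (H.continuousOn_triggerFunction hcont hr hr0 (hrT.trans (lt_add_one T).le)
        T ⟨hrT, (lt_add_one T).le⟩).eventually (Iio_mem_nhds hneg)
      have hc' : ∀ᶠ s in 𝓝[≥] T, triggerFunction G σ A β h x t i k s < 0 := by
        rw [← nhdsWithin_Icc_eq_nhdsGE (lt_add_one T)]
        exact nhdsWithin_mono _ (Icc_subset_Icc_left hrT) hc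
      obtain ⟨δ, hδ, hsub⟩ := mem_nhdsGE_iff_exists_Ico_subset.1 hc'
      exact ⟨δ, hδ, fun s hs => (hsub ⟨hs.1.le, hs.2⟩ : _ < (0 : ℝ)).le⟩
  have hge : (δ : EReal) ≤ t i (k + 1) := by
    rw [H.next_trigger]
    refine le_sInf ?_
    rintro _ ⟨s, rfl, hs, hsf⟩
    rw [EReal.coe_le_coe_iff]
    by_contra! hsδ
    have hsT : T ≤ s := by
      have : t i (k + 1) ≤ (s : EReal) := by rw [H.next_trigger]; exact sInf_le ⟨s, rfl, hs, hsf⟩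
      rwa [hT, EReal.coe_le_coe_iff] at this
    rcases hsT.eq_or_lt with rfl | hsT'
    · rw [hr, EReal.coe_lt_coe_iff] at hs
      exact absurd hsf (not_lt.2
        (H.triggerFunction_neg hσ hcont hpos hβ hτ hr hr0 hs hTτ.le hT.ge).le)
    · exact absurd hsf (not_lt.2 (hδf s ⟨hsT', hsδ⟩))
  rw [hT, EReal.coe_le_coe_iff] at hge
  exact absurd hδ (not_lt.2 hge)

lemma nsmul_le_trigger (H : IsTrajectory G σ A B K β h x t) {τ : ℝ}
    (hgap : ∀ i k, t i k + (τ : EReal) ≤ t i (k + 1)) (i : Fin N) (k : ℕ) :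
    ((k * τ : ℝ) : EReal) ≤ t i k := by
  induction k with
  | zero => simp [H.first_trigger]
  | succ k ih =>
    refine le_trans ?_ (hgap i k)
    rw [show ((k + 1 : ℕ) : ℝ) * τ = k * τ + τ by push_cast; ring, EReal.coe_add]
    exact add_le_add_left ih _

/-- Accumulated over all inter-event intervals, the triggering rule bounds the energy of the sampling
error by that of the relative estimates. -/
lemma integral_samplingError_le (H : IsTrajectory G σ A B K β h x t)
    (hcont : ContinuousOn h (Ici 0)) {τ : ℝ} (hτ : 0 < τ)
    (hgap : ∀ i k, t i k + (τ : EReal) ≤ t i (k + 1)) (i : Fin N) {T : ℝ} (hT : 0 ≤ T) :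
    ∫ s in (0 : ℝ)..T, (‖samplingError σ A x t i s‖ ^ 2
      - β i * ‖relEstimate G σ A x t i s‖ ^ 2 - β i * h s) ≤ 0 := by
  have hint : LocallyBoundedMeasurable fun s => ‖samplingError σ A x t i s‖ ^ 2
      - β i * ‖relEstimate G σ A x t i s‖ ^ 2 - β i * h s :=
    ((H.locallyBounded_samplingError i).norm_sq.sub
      ((H.locallyBounded_relEstimate i).norm_sq.const_mul _)).sub
      ((LocallyBoundedMeasurable.of_continuousOn hcont).const_mul _)
  have hind : ∀ (k : ℕ) (T : ℝ), 0 ≤ T → (T : EReal) ≤ t i k →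
      ∫ s in (0 : ℝ)..T, (‖samplingError σ A x t i s‖ ^ 2
        - β i * ‖relEstimate G σ A x t i s‖ ^ 2 - β i * h s) ≤ 0 := by
    intro k
    induction k with
    | zero =>
      intro T hT hTk
      rw [H.first_trigger, ← EReal.coe_zero, EReal.coe_le_coe_iff] at hTk
      rw [le_antisymm hTk hT, intervalIntegral.integral_same]
    | succ k ih =>
      intro T hT hTk
      rcases le_or_gt (T : EReal) (t i k) with hle | hlt
      · exact ih T hT hle
      rcases H.trigger_eq_top_or_coe i k with hk | ⟨r, hr0, hr⟩
      · rw [hk] at hlt; exact absurd hlt not_top_lt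
      have hrT : r < T := by rwa [hr, EReal.coe_lt_coe_iff] at hlt
      rw [← intervalIntegral.integral_add_adjacent_intervals (hint.intervalIntegrable le_rfl hr0)
        (hint.intervalIntegrable hr0 hrT.le), ← H.triggerFunction_eq hr hrT.le hTk]
      refine add_nonpos (ih r hr0 hr.ge) ?_
      -- At `T = t (k + 1)` the bound follows from the earlier times by continuity.
      have hcl : closure (Ioo r T) = Icc r T := closure_Ioo hrT.ne
      refine le_on_closure (f := triggerFunction G σ A β h x t i k) (g := fun _ => 0)
        (s := Ioo r T) (fun s hs => ?_) ?_ continuousOn_const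
        (by rw [hcl]; exact right_mem_Icc.2 hrT.le)
      · refine H.triggerFunction_nonpos ?_ ((EReal.coe_lt_coe_iff.2 hs.2).trans_le hTk)
        rw [hr]; exact EReal.coe_lt_coe_iff.2 hs.1
      · rw [hcl]; exact H.continuousOn_triggerFunction hcont hr hr0 hrT.le
  obtain ⟨k, hk⟩ := exists_nat_ge (T / τ)
  refine hind k T hT (le_trans ?_ (H.nsmul_le_trigger hgap i k))
  rw [EReal.coe_le_coe_iff]
  exact (div_le_iff₀ hτ).1 hk

end IsTrajectory

end Trajectory

/-! ### Bipartite consensus -/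

section Consensus

variable {N n m : ℕ}

/-- The deviation `zᵢ - (1/N) ∑ⱼ zⱼ` of the gauged state `zᵢ = σᵢ xᵢ` from the average. -/
noncomputable def disagreement (σ : Fin N → ℝ) (x : Fin N → ℝ → EuclideanSpace ℝ (Fin n))
    (i : Fin N) (s : ℝ) : EuclideanSpace ℝ (Fin n) :=
  σ i • x i s - (N : ℝ)⁻¹ • ∑ j, σ j • x j s

lemma sum_disagreement (σ : Fin N → ℝ) (x : Fin N → ℝ → EuclideanSpace ℝ (Fin n)) (s : ℝ) :
    ∑ i, disagreement σ x i s = 0 := by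
  rcases Nat.eq_zero_or_pos N with rfl | hN
  · simp
  have hN' : (N : ℝ) ≠ 0 := by positivity
  simp only [disagreement, Finset.sum_sub_distrib, Finset.sum_const, Finset.card_univ,
    Fintype.card_fin, ← Nat.cast_smul_eq_nsmul ℝ, smul_smul, mul_inv_cancel₀ hN', one_smul,
    sub_self]

lemma disagreement_sub (σ : Fin N → ℝ) (x : Fin N → ℝ → EuclideanSpace ℝ (Fin n))
    (i j : Fin N) (s : ℝ) :
    disagreement σ x i s - disagreement σ x j s = σ i • x i s - σ j • x j s := by
  simp [disagreement]

/-- Relative estimates are unchanged when the average is subtracted from all states. -/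
lemma relEstimate_eq {G : SignedGraph N} {σ : Fin N → ℝ} (hσ : G.IsGauge σ)
    (A : Matrix (Fin n) (Fin n) ℝ) (x : Fin N → ℝ → EuclideanSpace ℝ (Fin n))
    (t : Fin N → ℕ → EReal) (i : Fin N) (s : ℝ) :
    relEstimate G σ A x t i s = ∑ j, G.gaugedLaplacian σ i j •
      (disagreement σ x j s + samplingError σ A x t j s) := by
  rw [hσ.sum_gaugedLaplacian_smul, relEstimate]
  refine Finset.sum_congr rfl fun j _ => ?_
  congr 1
  simp only [disagreement, samplingError]
  abel

lemma sum_relEstimate (G : SignedGraph N) (σ : Fin N → ℝ)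
    (A : Matrix (Fin n) (Fin n) ℝ) (x : Fin N → ℝ → EuclideanSpace ℝ (Fin n))
    (t : Fin N → ℕ → EReal) (s : ℝ) : ∑ i, relEstimate G σ A x t i s = 0 := by
  simp only [relEstimate, smul_sub, Finset.sum_sub_distrib]
  rw [sub_eq_zero]
  conv_rhs => rw [Finset.sum_comm]
  simp_rw [fun i j => G.symm i j]

lemma sum_norm_relEstimate_sq_le (hσ : G.IsGauge σ) (A : Matrix (Fin n) (Fin n) ℝ)
    (x : Fin N → ℝ → EuclideanSpace ℝ (Fin n)) (t : Fin N → ℕ → EReal) (s : ℝ) :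
    ∑ i, ‖relEstimate G σ A x t i s‖ ^ 2 ≤ 2 * opNorm (G.gaugedLaplacian σ) ^ 2 *
      ((∑ i, ‖disagreement σ x i s‖ ^ 2) + ∑ i, ‖samplingError σ A x t i s‖ ^ 2) := by
  have h1 := sum_dotProduct_gaugedLaplacian_le (G.gaugedLaplacian σ)
    (fun i => (disagreement σ x i s + samplingError σ A x t i s).ofLp)
  have h2 : ∀ i, (∑ j, G.gaugedLaplacian σ i j •
      (disagreement σ x j s + samplingError σ A x t j s).ofLp)
      = (relEstimate G σ A x t i s).ofLp := fun i => by
    rw [relEstimate_eq hσ]; simp [WithLp.ofLp_sum]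
  simp only [h2, ← norm_toLp_sq, WithLp.toLp_ofLp] at h1
  refine h1.trans ?_
  rw [mul_comm 2, mul_assoc, ← Finset.sum_add_distrib]
  refine mul_le_mul_of_nonneg_left ?_ (sq_nonneg _)
  rw [Finset.mul_sum]
  refine Finset.sum_le_sum fun i _ => ?_
  have h3 := norm_add_le (disagreement σ x i s) (samplingError σ A x t i s)
  have h4 := pow_le_pow_left₀ (norm_nonneg (_ : EuclideanSpace ℝ (Fin n))) h3 2
  nlinarith [sq_nonneg (‖disagreement σ x i s‖ - ‖samplingError σ A x t i s‖)]

/-- A positive definite quadratic form is bounded below by a multiple of the squared norm. -/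
lemma Matrix.PosDef.exists_mul_norm_sq_le {P : Matrix (Fin n) (Fin n) ℝ} (hP : P.PosDef) :
    ∃ μ > 0, ∀ v : EuclideanSpace ℝ (Fin n),
      μ * ‖v‖ ^ 2 ≤ inner ℝ v (Matrix.toEuclideanCLM (𝕜 := ℝ) P v) := by
  set Φ := Matrix.toEuclideanCLM (𝕜 := ℝ) P
  have hpos : ∀ v : EuclideanSpace ℝ (Fin n), v ≠ 0 → 0 < inner ℝ v (Φ v) := by
    intro v hv
    have := hP.dotProduct_mulVec_pos (x := v.ofLp) (by simpa using hv)
    rw [EuclideanSpace.inner_eq_star_dotProduct, Matrix.ofLp_toEuclideanCLM, dotProduct_comm]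
    exact this
  have hscale : ∀ {μ : ℝ}, (∀ u : EuclideanSpace ℝ (Fin n), ‖u‖ = 1 → μ ≤ inner ℝ u (Φ u)) →
      ∀ v, μ * ‖v‖ ^ 2 ≤ inner ℝ v (Φ v) := by
    intro μ h v
    rcases eq_or_ne v 0 with rfl | hv
    · simp
    have hv' : ‖v‖ ≠ 0 := norm_ne_zero_iff.2 hv
    have h1 := h (‖v‖⁻¹ • v) (by rw [norm_smul, norm_inv, norm_norm, inv_mul_cancel₀ hv'])
    rw [map_smul, inner_smul_left, inner_smul_right, RCLike.conj_to_real, ← mul_assoc, ← mul_inv,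
      ← div_eq_inv_mul, le_div_iff₀ (by positivity)] at h1
    rwa [pow_two]
  rcases (Metric.sphere (0 : EuclideanSpace ℝ (Fin n)) 1).eq_empty_or_nonempty with he | hne
  · exact ⟨1, one_pos, hscale fun u hu => absurd (mem_sphere_zero_iff_norm.2 hu) (by simp [he])⟩
  · obtain ⟨u, hu, hmin⟩ := (isCompact_sphere (0 : EuclideanSpace ℝ (Fin n)) 1).exists_isMinOn hne
      (f := fun v => inner ℝ v (Φ v)) (by fun_prop)
    refine ⟨_, hpos u ?_, hscale fun w hw => hmin (mem_sphere_zero_iff_norm.2 hw)⟩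
    rintro rfl
    simp at hu

/-- The Lyapunov function `∑ᵢ yᵢᵀ P yᵢ` of the disagreement vector `y`. -/
noncomputable def consensusEnergy (σ : Fin N → ℝ) (P : Matrix (Fin n) (Fin n) ℝ)
    (x : Fin N → ℝ → EuclideanSpace ℝ (Fin n)) (s : ℝ) : ℝ :=
  ∑ i, inner ℝ (disagreement σ x i s) (Matrix.toEuclideanCLM (𝕜 := ℝ) P (disagreement σ x i s))

namespace IsTrajectory

variable {G : SignedGraph N} {σ : Fin N → ℝ} {A : Matrix (Fin n) (Fin n) ℝ}
  {B : Matrix (Fin n) (Fin m) ℝ} {K : Matrix (Fin m) (Fin n) ℝ} {β : Fin N → ℝ} {h : ℝ → ℝ}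
  {x : Fin N → ℝ → EuclideanSpace ℝ (Fin n)} {t : Fin N → ℕ → EReal}

lemma continuousOn_disagreement (H : IsTrajectory G σ A B K β h x t) (i : Fin N) :
    ContinuousOn (disagreement σ x i) (Ici 0) := by
  have h1 : ContinuousOn (fun s => ∑ j, σ j • x j s) (Ici 0) :=
    continuousOn_finsetSum _ fun j _ => (H.continuousOn j).const_smul (σ j)
  exact ((H.continuousOn i).const_smul (σ i)).sub (h1.const_smul (N : ℝ)⁻¹)

lemma hasDerivWithinAt_disagreement (H : IsTrajectory G σ A B K β h x t) (hσ : G.IsGauge σ)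
    (i : Fin N) {s : ℝ} (hs : 0 ≤ s) :
    HasDerivWithinAt (disagreement σ x i) (Matrix.toEuclideanLin A (disagreement σ x i s)
      - Matrix.toEuclideanLin (B * K) (relEstimate G σ A x t i s)) (Ici s) s := by
  have hsum : HasDerivWithinAt (fun s => ∑ j, σ j • x j s)
      (Matrix.toEuclideanLin A (∑ j, σ j • x j s)) (Ici s) s := by
    refine (HasDerivWithinAt.fun_sum fun j _ => H.hasDerivWithinAt_gauged hσ j hs).congr_deriv ?_
    rw [Finset.sum_sub_distrib, ← map_sum, ← map_sum, sum_relEstimate, map_zero, sub_zero]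
  refine ((H.hasDerivWithinAt_gauged hσ i hs).sub (hsum.const_smul (N : ℝ)⁻¹)).congr_deriv ?_
  rw [disagreement, map_sub, map_smul _ (N : ℝ)⁻¹]
  abel

/-- Integrated Lyapunov estimate along a trajectory. -/
lemma consensusEnergy_sub_le {P : Matrix (Fin n) (Fin n) ℝ}
    (H : IsTrajectory G σ A B (Bᵀ * P) β h x t) (hσ : G.IsGauge σ)
    (hconn : G.toSimpleGraph.Connected) (hP : P.PosDef) {κ : ℝ}
    (hLMI : (-(κ • (1 : Matrix (Fin n) (Fin n) ℝ)) -
      (Aᵀ * P + P * A - algConnectivity G.laplacian • (P * B * Bᵀ * P))).PosDef)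
    {c : ℝ} (hc : 0 < c) {b : ℝ}
    (hb : b = κ - c * opNorm (G.gaugedLaplacian σ ⊗ₖ (P * B * Bᵀ * P)) ^ 2)
    {r T : ℝ} (hr : 0 ≤ r) (hrT : r ≤ T) :
    consensusEnergy σ P x T - consensusEnergy σ P x r ≤
      ∫ s in r..T, (-b * ∑ i, ‖disagreement σ x i s‖ ^ 2
        + 1 / c * ∑ i, ‖samplingError σ A x t i s‖ ^ 2) := by
  set Φ := Matrix.toEuclideanCLM (𝕜 := ℝ) P
  have hPt : Pᵀ = P := by simpa using hP.1.eq
  have hsymm : ∀ u v : EuclideanSpace ℝ (Fin n), inner ℝ u (Φ v) = u.ofLp ⬝ᵥ P *ᵥ v.ofLp := by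
    intro u v
    rw [EuclideanSpace.inner_eq_star_dotProduct, Matrix.ofLp_toEuclideanCLM, dotProduct_comm]
    rfl
  have hcomm : ∀ u v : EuclideanSpace ℝ (Fin n), inner ℝ u (Φ v) = inner ℝ v (Φ u) := by
    intro u v
    rw [hsymm, hsymm, Matrix.dotProduct_mulVec, ← Matrix.mulVec_transpose, hPt, dotProduct_comm]
  have hcontV : ContinuousOn (consensusEnergy σ P x) (Ici 0) :=
    continuousOn_finsetSum _ fun i _ => (H.continuousOn_disagreement i).inner
      (Φ.continuous.comp_continuousOn (H.continuousOn_disagreement i))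
  refine intervalIntegral.sub_le_integral_of_hasDeriv_right_of_le hrT
    (g' := fun s => ∑ i, 2 * inner ℝ (disagreement σ x i s)
      (Φ (Matrix.toEuclideanLin A (disagreement σ x i s)
        - Matrix.toEuclideanLin (B * (Bᵀ * P)) (relEstimate G σ A x t i s))))
    (hcontV.mono fun s hs => hr.trans hs.1) ?_ ?_ ?_
  · intro s hs
    have hs0 : 0 ≤ s := hr.trans hs.1.le
    refine HasDerivWithinAt.fun_sum fun i _ => ?_
    have h1 := (H.hasDerivWithinAt_disagreement hσ i hs0).mono Ioi_subset_Ici_self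
    refine (h1.inner ℝ (Φ.hasFDerivAt.comp_hasDerivWithinAt s h1)).congr_deriv ?_
    rw [Function.comp_apply, hcomm (Matrix.toEuclideanLin A _ - _)]
    ring
  · exact ((LocallyBoundedMeasurable.finsetSum _ fun i =>
      (LocallyBoundedMeasurable.of_continuousOn (H.continuousOn_disagreement i)).norm_sq).const_mul
        _ |>.add ((LocallyBoundedMeasurable.finsetSum _ fun i =>
          (H.locallyBounded_samplingError i).norm_sq).const_mul _)).integrableOn hr
  · intro s _
    have h1 := lyapunov_decay hσ hconn hP hLMI hc hb (fun i => (disagreement σ x i s).ofLp)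
      (fun i => (samplingError σ A x t i s).ofLp)
      (by rw [← WithLp.ofLp_sum, sum_disagreement, WithLp.ofLp_zero])
    simp only [← norm_toLp_sq, WithLp.toLp_ofLp] at h1
    refine le_trans (le_of_eq ?_) h1
    refine Finset.sum_congr rfl fun i _ => ?_
    rw [hsymm, relEstimate_eq hσ]
    simp [Matrix.toLpLin_apply, Matrix.mulVec_mulVec, WithLp.ofLp_sum, Matrix.mulVec_sum]

/-- The total sampling error is dominated by the total disagreement: the factor `δ / (1 - δ)` comes
from absorbing the sampling errors that are contained in the relative estimates. -/
lemma integral_sum_samplingError_le (H : IsTrajectory G σ A B K β h x t) (hσ : G.IsGauge σ)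
    (hcont : ContinuousOn h (Ici 0)) (hpos : ∀ s, 0 ≤ s → 0 < h s)
    (hint : ∫ s in Ioi (0 : ℝ), h s = 1) (hβ : ∀ i, 0 < β i) {τ : ℝ} (hτ : 0 < τ)
    (hgap : ∀ i k, t i k + (τ : EReal) ≤ t i (k + 1)) {δ : ℝ} (hδ : δ < 1)
    (hβδ : ∀ i, β i * (2 * opNorm (G.gaugedLaplacian σ) ^ 2) ≤ δ) {T : ℝ} (hT : 0 ≤ T) :
    ∫ s in (0 : ℝ)..T, ∑ i, ‖samplingError σ A x t i s‖ ^ 2 ≤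
      δ / (1 - δ) * (∫ s in (0 : ℝ)..T, ∑ i, ‖disagreement σ x i s‖ ^ 2)
        + (∑ i, β i) / (1 - δ) := by
  set E : ℝ → ℝ := fun s => ∑ i, ‖samplingError σ A x t i s‖ ^ 2
  set Y : ℝ → ℝ := fun s => ∑ i, ‖disagreement σ x i s‖ ^ 2
  have hE : IntervalIntegrable E volume 0 T := (LocallyBoundedMeasurable.finsetSum _ fun i =>
    (H.locallyBounded_samplingError i).norm_sq).intervalIntegrable le_rfl hT
  have hY : IntervalIntegrable Y volume 0 T := (LocallyBoundedMeasurable.finsetSum _ fun i =>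
    (LocallyBoundedMeasurable.of_continuousOn
      (H.continuousOn_disagreement i)).norm_sq).intervalIntegrable le_rfl hT
  have hhint : IntegrableOn h (Ioi 0) := by
    by_contra hcon
    rw [integral_undef hcon] at hint
    exact zero_ne_one hint
  have hh : ∫ s in (0 : ℝ)..T, h s ≤ 1 := by
    rw [← hint, intervalIntegral.integral_of_le hT]
    refine setIntegral_mono_set hhint ?_ Ioc_subset_Ioi_self.eventuallyLE
    filter_upwards [ae_restrict_mem measurableSet_Ioi] with s hs
    exact (hpos s (mem_Ioi.1 hs).le).le
  have herr := fun i => (H.locallyBounded_samplingError i).norm_sq.intervalIntegrable le_rfl hT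
  have hrel := fun i => (H.locallyBounded_relEstimate i).norm_sq.intervalIntegrable le_rfl hT
  have hhi : IntervalIntegrable h volume 0 T :=
    (LocallyBoundedMeasurable.of_continuousOn hcont).intervalIntegrable le_rfl hT
  have hi : ∀ i, ∫ s in (0 : ℝ)..T, ‖samplingError σ A x t i s‖ ^ 2 ≤
      (∫ s in (0 : ℝ)..T, β i * ‖relEstimate G σ A x t i s‖ ^ 2) + β i := by
    intro i
    have h1 := H.integral_samplingError_le hcont hτ hgap i hT
    rw [intervalIntegral.integral_sub ((herr i).sub ((hrel i).const_mul _)) (hhi.const_mul _),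
      intervalIntegral.integral_sub (herr i) ((hrel i).const_mul _),
      intervalIntegral.integral_const_mul (β i) h] at h1
    have h2 := mul_le_mul_of_nonneg_left hh (hβ i).le
    linarith
  have hrelδ : ∀ s, ∑ i, β i * ‖relEstimate G σ A x t i s‖ ^ 2 ≤ δ * (Y s + E s) := by
    intro s
    have h1 := sum_norm_relEstimate_sq_le hσ A x t s
    have hYE : 0 ≤ Y s + E s := by positivity
    rcases isEmpty_or_nonempty (Fin N) with hN | hN
    · simp [Y, E]
    obtain ⟨i₀, hi₀⟩ := Finite.exists_max β
    calc ∑ i, β i * ‖relEstimate G σ A x t i s‖ ^ 2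
        ≤ ∑ i, β i₀ * ‖relEstimate G σ A x t i s‖ ^ 2 :=
          Finset.sum_le_sum fun i _ => mul_le_mul_of_nonneg_right (hi₀ i) (by positivity)
      _ = β i₀ * ∑ i, ‖relEstimate G σ A x t i s‖ ^ 2 := by rw [Finset.mul_sum]
      _ ≤ β i₀ * (2 * opNorm (G.gaugedLaplacian σ) ^ 2 * (Y s + E s)) :=
          mul_le_mul_of_nonneg_left h1 (hβ i₀).le
      _ = β i₀ * (2 * opNorm (G.gaugedLaplacian σ) ^ 2) * (Y s + E s) := by ring
      _ ≤ δ * (Y s + E s) := mul_le_mul_of_nonneg_right (hβδ i₀) hYE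
  have hsum : ∫ s in (0 : ℝ)..T, E s ≤
      δ * ((∫ s in (0 : ℝ)..T, Y s) + ∫ s in (0 : ℝ)..T, E s) + ∑ i, β i := by
    calc ∫ s in (0 : ℝ)..T, E s
        = ∑ i, ∫ s in (0 : ℝ)..T, ‖samplingError σ A x t i s‖ ^ 2 :=
          intervalIntegral.integral_finsetSum fun i _ => herr i
      _ ≤ ∑ i, ((∫ s in (0 : ℝ)..T, β i * ‖relEstimate G σ A x t i s‖ ^ 2) + β i) :=
          Finset.sum_le_sum fun i _ => hi i
      _ = (∫ s in (0 : ℝ)..T, ∑ i, β i * ‖relEstimate G σ A x t i s‖ ^ 2) + ∑ i, β i := by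
          rw [Finset.sum_add_distrib,
            intervalIntegral.integral_finsetSum fun i _ => (hrel i).const_mul _]
      _ ≤ (∫ s in (0 : ℝ)..T, δ * (Y s + E s)) + ∑ i, β i := by
          refine add_le_add (intervalIntegral.integral_mono_on hT ?_ ((hY.add hE).const_mul δ)
            fun s _ => hrelδ s) le_rfl
          exact (LocallyBoundedMeasurable.finsetSum _ fun i =>
            (H.locallyBounded_relEstimate i).norm_sq.const_mul (β i)).intervalIntegrable le_rfl hT
      _ = _ := by rw [intervalIntegral.integral_const_mul, intervalIntegral.integral_add hY hE]
  have hδ' : 0 < 1 - δ := by linarith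
  rw [div_mul_eq_mul_div, ← add_div, le_div_iff₀ hδ']
  linarith

end IsTrajectory

end Consensus

theorem mainTheorem1 {N n m : ℕ} (hN : 2 ≤ N)
    (A : Matrix (Fin n) (Fin n) ℝ) (B : Matrix (Fin n) (Fin m) ℝ) (hAB : Stabilizable A B)
    (G : SignedGraph N) (hconn : G.toSimpleGraph.Connected) (hbal : G.StructurallyBalanced)
    (σ : Fin N → ℝ) (hσ : G.IsGauge σ)
    (P : Matrix (Fin n) (Fin n) ℝ) (hP : P.PosDef) (κ : ℝ) (hκ : 0 < κ)
    (hLMI : (-(κ • (1 : Matrix (Fin n) (Fin n) ℝ)) -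
      (Aᵀ * P + P * A - algConnectivity G.laplacian • (P * B * Bᵀ * P))).PosDef)
    (h : ℝ → ℝ) (hcont : ContinuousOn h (Set.Ici 0)) (hpos : ∀ s, 0 ≤ s → 0 < h s)
    (hint : ∫ s in Set.Ioi (0 : ℝ), h s = 1)
    (c : ℝ) (hc : 0 < c) (b : ℝ)
    (hb : b = κ - c * opNorm (G.gaugedLaplacian σ ⊗ₖ (P * B * Bᵀ * P)) ^ 2) (hb_pos : 0 < b)
    (β : Fin N → ℝ) (hβ_pos : ∀ i, 0 < β i)
    (hβ : ∀ i, β i < min (1 / (2 * opNorm (G.gaugedLaplacian σ) ^ 2))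
      (b * c / (2 * opNorm (G.gaugedLaplacian σ) ^ 2 * (b * c + 1)))) :
    (∀ (x : Fin N → ℝ → EuclideanSpace ℝ (Fin n)) (t : Fin N → ℕ → EReal),
      IsTrajectory G σ A B (Bᵀ * P) β h x t →
        ∀ i j, Filter.Tendsto (fun s => ‖σ i • x i s - σ j • x j s‖) Filter.atTop (nhds 0)) ∧
    ∃ τ : ℝ, 0 < τ ∧
      ∀ (x : Fin N → ℝ → EuclideanSpace ℝ (Fin n)) (t : Fin N → ℕ → EReal),
        IsTrajectory G σ A B (Bᵀ * P) β h x t →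
          ∀ i k, t i k + (τ : EReal) ≤ t i (k + 1) := by
  have : Nonempty (Fin N) := ⟨⟨0, by omega⟩⟩
  obtain ⟨τ, hτ, hτβ⟩ : ∃ τ : ℝ, 0 < τ ∧ ∀ i,
      τ * (Real.exp ((2 * opNorm A + 1) * τ) * opNorm (B * (Bᵀ * P)) ^ 2) ≤ β i := by
    have hlim : Tendsto (fun τ : ℝ =>
        τ * (Real.exp ((2 * opNorm A + 1) * τ) * opNorm (B * (Bᵀ * P)) ^ 2)) (𝓝[>] 0) (𝓝 0) := by
      have : Continuous fun τ : ℝ =>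
        τ * (Real.exp ((2 * opNorm A + 1) * τ) * opNorm (B * (Bᵀ * P)) ^ 2) := by fun_prop
      simpa using (this.tendsto 0).mono_left nhdsWithin_le_nhds
    obtain ⟨τ, hτβ, hτ⟩ := ((eventually_all.2 fun i =>
      hlim.eventually (Iic_mem_nhds (hβ_pos i))).and self_mem_nhdsWithin).exists
    exact ⟨τ, hτ, hτβ⟩
  have hgap : ∀ (x : Fin N → ℝ → EuclideanSpace ℝ (Fin n)) (t : Fin N → ℕ → EReal),
      IsTrajectory G σ A B (Bᵀ * P) β h x t → ∀ i k, t i k + (τ : EReal) ≤ t i (k + 1) :=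
    fun x t H => H.trigger_add_le hσ hcont hpos hβ_pos hτβ
  refine ⟨fun x t H i j => ?_, τ, hτ, hgap⟩
  obtain ⟨i₀, hi₀⟩ := Finite.exists_max β
  set ℓ := 2 * opNorm (G.gaugedLaplacian σ) ^ 2 with hℓ
  -- `0 < β i₀ < 1 / ℓ` rules out `ℓ = 0`, where `1 / ℓ` would be `0`.
  have hℓ0 : 0 < ℓ := one_div_pos.1 ((hβ_pos i₀).trans ((hβ i₀).trans_le (min_le_left _ _)))
  have hbc : 0 < b * c := mul_pos hb_pos hc
  set δ := β i₀ * ℓ with hδ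
  have hδ1 : δ < 1 := (lt_div_iff₀ hℓ0).1 ((hβ i₀).trans_le (min_le_left _ _))
  have hδbc : δ * (b * c + 1) < b * c := by
    have := (lt_div_iff₀ (mul_pos hℓ0 (by linarith))).1 ((hβ i₀).trans_le (min_le_right _ _))
    rwa [← mul_assoc] at this
  have hgain : δ / (1 - δ) / c < b := by
    rw [div_lt_iff₀ hc, div_lt_iff₀ (by linarith)]
    linarith
  set Φ := Matrix.toEuclideanCLM (𝕜 := ℝ) P
  obtain ⟨μ, hμ, hμP⟩ := hP.exists_mul_norm_sq_le
  have hμV : ∀ s i, μ * ‖disagreement σ x i s‖ ^ 2 ≤ consensusEnergy σ P x s := fun s i =>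
    (hμP _).trans (Finset.single_le_sum (f := fun i => inner ℝ (disagreement σ x i s)
      (Φ (disagreement σ x i s))) (fun j _ => le_trans (by positivity) (hμP _)) (Finset.mem_univ i))
  have hV : Tendsto (consensusEnergy σ P x) atTop (𝓝 0) := by
    refine tendsto_zero_of_dissipation (p := ‖Φ‖ + 1) (by positivity) hc hb_pos hgain
      (Y := fun s => ∑ i, ‖disagreement σ x i s‖ ^ 2)
      (e := fun s => ∑ i, ‖samplingError σ A x t i s‖ ^ 2)
      (fun s _ => le_trans (by positivity) (hμV s i₀)) (fun s _ => by positivity)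
      (fun s _ => by positivity) (fun s T hs hsT => ?_) (fun s T hs hsT => ?_) (fun s _ => ?_)
      (fun s T hs hsT => H.consensusEnergy_sub_le hσ hconn hP hLMI hc hb hs hsT)
      (fun T hT => H.integral_sum_samplingError_le hσ hcont hpos hint hβ_pos hτ (hgap x t H) hδ1
        (fun i => mul_le_mul_of_nonneg_right (hi₀ i) hℓ0.le) hT)
    · exact (LocallyBoundedMeasurable.finsetSum _ fun i => (LocallyBoundedMeasurable.of_continuousOn
        (H.continuousOn_disagreement i)).norm_sq).intervalIntegrable hs hsT
    · exact (LocallyBoundedMeasurable.finsetSum _ fun i =>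
        (H.locallyBounded_samplingError i).norm_sq).intervalIntegrable hs hsT
    · rw [consensusEnergy, Finset.mul_sum]
      refine Finset.sum_le_sum fun i _ => (real_inner_le_norm _ _).trans ?_
      have := mul_le_mul_of_nonneg_left (Φ.le_opNorm (disagreement σ x i s))
        (norm_nonneg (disagreement σ x i s))
      nlinarith [sq_nonneg ‖disagreement σ x i s‖]
  have hy : ∀ i, Tendsto (fun s => ‖disagreement σ x i s‖) atTop (𝓝 0) := by
    intro i
    have h1 : Tendsto (fun s => Real.sqrt (consensusEnergy σ P x s / μ)) atTop (𝓝 0) := by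
      simpa using (hV.div_const μ).sqrt
    refine squeeze_zero (fun _ => norm_nonneg _) (fun s => Real.le_sqrt_of_sq_le ?_) h1
    rw [le_div_iff₀ hμ, mul_comm]
    exact hμV s i
  refine squeeze_zero (fun _ => norm_nonneg _) (fun s => ?_) (by simpa using (hy i).add (hy j))
  rw [← disagreement_sub]
  exact norm_sub_le _ _
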